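/- A \emph{necklace} is a tuple $\mathbf N=((n_1,L_1),\dots,(n_k,L_k))$, $k\ge 1$, of positive integers $n_j$ and positive reals $L_j$; put $n=n_1+\dots+n_k$. It is \emph{realisable} if $2L_j<L_1+\dots+L_k$ for every $j$ with $n_j=1$. For a planar $n$-gon $P=(p_1,\dots,p_n)\in(\mathbb R^2)^n=\mathbb R^{2n}$ (indices cyclic modulo $n$) let $$\mathcal L_j(P)=\sum_{i=n_1+\dots+n_{j-1}+1}^{n_1+\dots+n_j}|p_{i+1}-p_i|,\qquad j=1,\dots,k.$$ A \emph{configuration} of $\mathbf N$ is a $P$ with $\mathcal L_j(P)=L_j$ for all $j$; it is \emph{non-singular} if $\mathcal L=(\mathcal L_1,\dots,\mathcal L_k)\colon\mathbb R^{2n}\to\mathbb R^k$ is differentiable at $P$ with surjective differential. Let $\tilde{\mathcal M}_{sm}(\mathbf N)\subset\mathbb R^{2n}$ be the set of non-singular configurations and let $\mathcal M_{sm}(\mathbf N)=\tilde{\mathcal M}_{sm}(\mathbf N)/\mathrm{Isom}_+(\mathbb R^2)$ be its quotient, with the quotient topology, by the diagonal action of the group of orientation-preserving isometries of the plane. The \emph{oriented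 area} of $P=((x_1,y_1),\dots,(x_n,y_n))$ is $\mathcal A(P)=\frac12\sum_{i=1}^n(x_iy_{i+1}-x_{i+1}y_i)$; it is invariant under $\mathrm{Isom}_+(\mathbb R^2)$ and so defines a function $\mathcal A$ on $\mathcal M_{sm}(\mathbf N)$. \textbf{Proposition.} Let $\mathbf N$ be a realisable necklace. Then $\tilde{\mathcal M}_{sm}(\mathbf N)$ is non-empty, $2n-k-3\ge 0$, and \begin{enumerate} \item $\tilde{\mathcal M}_{sm}(\mathbf N)$ is a smooth (embedded) submanifold of dimension $2n-k$ in $\mathbb R^{2n}$; \item $\mathcal M_{sm}(\mathbf N)$ is a topological manifold (Hausdorff, second countable) of dimension $2n-k-3$, and it has a unique smooth structure making the quotient map $\tilde{\mathcal M}_{sm}(\mathbf N)\to\mathcal M_{sm}(\mathbf N)$ a smooth submersion; \item the oriented area $\mathcal A$ is a smooth function on $\mathcal M_{sm}(\mathbf N)$ with this smooth structure. \end{enumerate} -/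

import Mathlib

open scoped Manifold ContDiff

noncomputable section

/-- The Euclidean plane `ℝ²`. -/
abbrev Plane : Type := EuclideanSpace ℝ (Fin 2)

/-- The space `(ℝ²)ⁿ` of planar `n`-gons: `n`-tuples of labelled points, arbitrary position. -/
abbrev PlanarPolygon (n : ℕ) : Type := Fin n → Plane

/-- The length `|pᵢ pᵢ₊₁|` of the `i`-th side; `finRotate n` is the cyclic successor `i ↦ i + 1`
on `Fin n`. -/
def sideLength {n : ℕ} (i : Fin n) (P : PlanarPolygon n) : ℝ :=
  dist (P i) (P (finRotate n i))

/-- The determinant `x₁ y₂ - x₂ y₁` of two vectors of the plane. -/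
def planeDet (u v : Plane) : ℝ := u 0 * v 1 - v 0 * u 1

/-- The oriented area of an `n`-gon: half the sum of the determinants of consecutive vertices. -/
def orientedArea {n : ℕ} (P : PlanarPolygon n) : ℝ :=
  ∑ i, (1 / 2 : ℝ) * planeDet (P i) (P (finRotate n i))

/-! ### Orientation-preserving isometries -/

/-- The group of orientation-preserving isometries of the plane: affine isometries whose linear
part has positive determinant. -/
def IsomPlus : Subgroup (Plane ≃ᵃⁱ[ℝ] Plane) where
  carrier := {g | 0 < LinearMap.det (g.linearIsometryEquiv.toLinearEquiv : Plane →ₗ[ℝ] Plane)}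
  one_mem' := by
    have h : ((1 : Plane ≃ᵃⁱ[ℝ] Plane).linearIsometryEquiv.toLinearEquiv : Plane →ₗ[ℝ] Plane)
        = LinearMap.id := rfl
    change (0 : ℝ) < LinearMap.det _
    rw [h, LinearMap.det_id]
    exact zero_lt_one
  mul_mem' := by
    intro a b ha hb
    have h : ((a * b).linearIsometryEquiv.toLinearEquiv : Plane →ₗ[ℝ] Plane)
        = (a.linearIsometryEquiv.toLinearEquiv : Plane →ₗ[ℝ] Plane) ∘ₗ
          (b.linearIsometryEquiv.toLinearEquiv : Plane →ₗ[ℝ] Plane) := rfl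
    change (0 : ℝ) < LinearMap.det _ at ha hb ⊢
    rw [h, LinearMap.det_comp]
    exact mul_pos ha hb
  inv_mem' := by
    intro a ha
    change (0 : ℝ) < LinearMap.det _ at ha ⊢
    have h : (a.linearIsometryEquiv.toLinearEquiv : Plane →ₗ[ℝ] Plane) ∘ₗ
        ((a⁻¹).linearIsometryEquiv.toLinearEquiv : Plane →ₗ[ℝ] Plane) = LinearMap.id := by
      ext1 x
      exact a.linearIsometryEquiv.apply_symm_apply x
    have h2 := congrArg LinearMap.det h
    rw [LinearMap.det_comp, LinearMap.det_id] at h2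
    exact pos_of_mul_pos_right (h2 ▸ zero_lt_one) ha.le

/-- The tautological action of orientation-preserving isometries on the plane. The action on
`PlanarPolygon n` is then the diagonal one, `(g • P) i = g • P i`. -/
instance : MulAction IsomPlus Plane where
  smul g x := (g : Plane ≃ᵃⁱ[ℝ] Plane) x
  one_smul _ := rfl
  mul_smul _ _ _ := rfl

theorem IsomPlus.smul_def (g : IsomPlus) (x : Plane) : g • x = (g : Plane ≃ᵃⁱ[ℝ] Plane) x := rfl

theorem IsomPlus.exists_matrix (g : IsomPlus) : ∃ a b c d s t : ℝ, a * d - b * c = 1 ∧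
    ∀ x : Plane, (g • x) 0 = a * x 0 + b * x 1 + s ∧ (g • x) 1 = c * x 0 + d * x 1 + t := by
  set A : Plane ≃ₗᵢ[ℝ] Plane := (g : Plane ≃ᵃⁱ[ℝ] Plane).linearIsometryEquiv with hA
  set u : Plane := A (EuclideanSpace.single 0 1) with hu
  set v : Plane := A (EuclideanSpace.single 1 1) with hv
  have hpos : 0 < u 0 * v 1 - v 0 * u 1 := by
    have h : 0 < LinearMap.det (A.toLinearEquiv : Plane →ₗ[ℝ] Plane) := g.2
    rw [← LinearMap.det_toMatrix (EuclideanSpace.basisFun (Fin 2) ℝ).toBasis,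
      Matrix.det_fin_two] at h
    simpa [LinearMap.toMatrix_apply, hu, hv] using h
  have huu : inner ℝ u u = (1 : ℝ) := by rw [hu, A.inner_map_map]; simp
  have hvv : inner ℝ v v = (1 : ℝ) := by rw [hv, A.inner_map_map]; simp
  have huv : inner ℝ u v = (0 : ℝ) := by
    rw [hu, hv, A.inner_map_map]
    simp [PiLp.inner_apply]
  simp only [PiLp.inner_apply, Fin.sum_univ_two, RCLike.inner_apply, conj_trivial]
    at huu hvv huv
  have hsq : (u 0 * v 1 - v 0 * u 1) ^ 2 = 1 := by
    linear_combination (v 0 * v 0 + v 1 * v 1) * huu + hvv - (v 0 * u 0 + v 1 * u 1) * huv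
  refine ⟨u 0, v 0, u 1, v 1, (g • (0 : Plane)) 0, (g • (0 : Plane)) 1, ?_, fun x => ?_⟩
  · nlinarith
  · have hx : x = x 0 • EuclideanSpace.single 0 (1 : ℝ) + x 1 • EuclideanSpace.single 1 (1 : ℝ) := by
      ext i
      fin_cases i <;> simp
    have hAx : A x = x 0 • u + x 1 • v := by
      conv_lhs => rw [hx]
      rw [map_add, map_smul, map_smul]
    have hgx : g • x = A x + g • (0 : Plane) := by
      have := (g : Plane ≃ᵃⁱ[ℝ] Plane).map_vadd 0 x
      simpa [IsomPlus.smul_def] using this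
    rw [hgx, hAx]
    constructor <;> simp <;> ring

theorem orientedArea_smul {n : ℕ} (g : IsomPlus) (P : PlanarPolygon n) :
    orientedArea (g • P) = orientedArea P := by
  obtain ⟨a, b, c, d, s, t, hdet, hg⟩ := IsomPlus.exists_matrix g
  have key : ∀ u v : Plane, planeDet (g • u) (g • v) = planeDet u v
      + ((a * t - c * s) * u 0 + (b * t - d * s) * u 1)
      - ((a * t - c * s) * v 0 + (b * t - d * s) * v 1) := by
    intro u v
    simp only [planeDet, (hg u).1, (hg u).2, (hg v).1, (hg v).2]
    linear_combination (u 0 * v 1 - v 0 * u 1) * hdet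
  have hsum : ∑ i, ((a * t - c * s) * P i 0 + (b * t - d * s) * P i 1) =
      ∑ i, ((a * t - c * s) * P (finRotate n i) 0 + (b * t - d * s) * P (finRotate n i) 1) :=
    (Equiv.sum_comp (finRotate n)
      (fun i => (a * t - c * s) * P i 0 + (b * t - d * s) * P i 1)).symm
  simp only [orientedArea, Pi.smul_apply, ← Finset.mul_sum, key, Finset.sum_sub_distrib]
  rw [Finset.sum_add_distrib, hsum]
  ring

/-! ### Necklaces -/

/-- A necklace `((n₁, L₁), …, (n_k, L_k))`, `k ≥ 1`, with positive integers `n_j` (`count`) and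
positive reals `L_j` (`length`). -/
structure Necklace where
  k : ℕ
  k_pos : 0 < k
  count : Fin k → ℕ
  count_pos : ∀ j, 0 < count j
  length : Fin k → ℝ
  length_pos : ∀ j, 0 < length j

namespace Necklace

variable (N : Necklace)

/-- The total number `n = n₁ + … + n_k` of beads. -/
def n : ℕ := ∑ j, N.count j

/-- The set `j*` of indices of the sides in the `j`-th piece (counting indices from `0`):
`n₁ + … + n_{j-1} ≤ i < n₁ + … + n_j`. -/
def piece (j : Fin N.k) : Finset (Fin N.n) :=
  {i | ∑ a ∈ Finset.Iio j, N.count a ≤ (i : ℕ) ∧ (i : ℕ) < ∑ a ∈ Finset.Iic j, N.count a}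

/-- The map `(𝓛₁, …, 𝓛_k) : PlanarPolygon n → ℝᵏ`, where `𝓛_j` is the total length of the sides in the
`j`-th piece. -/
def pieceLengths (P : PlanarPolygon N.n) : Fin N.k → ℝ :=
  fun j => ∑ i ∈ N.piece j, sideLength i P

/-- `P` is a (strained planar) configuration of the necklace. -/
def IsConfiguration (P : PlanarPolygon N.n) : Prop := ∀ j, N.pieceLengths P j = N.length j

/-- `P` is non-singular for the necklace: the map of piece lengths is differentiable at `P` with
surjective differential. -/
def IsSubmersiveAt (P : PlanarPolygon N.n) : Prop :=
  DifferentiableAt ℝ N.pieceLengths P ∧ Function.Surjective (fderiv ℝ N.pieceLengths P)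

/-- The set of non-singular configurations of the necklace. -/
def nonsingularConfigurations : Set (PlanarPolygon N.n) :=
  {P | N.IsConfiguration P ∧ N.IsSubmersiveAt P}

/-- Two non-singular configurations are equivalent if they lie in one orbit of the group of
orientation-preserving isometries of the plane. -/
def configurationSetoid : Setoid N.nonsingularConfigurations :=
  (MulAction.orbitRel IsomPlus (PlanarPolygon N.n)).comap Subtype.val

/-- The non-singular part of the configuration space of the necklace: the quotient of the space of
non-singular configurations by orientation-preserving isometries, with the quotient topology. -/
def SmoothModuli : Type := Quotient N.configurationSetoid

instance : TopologicalSpace N.SmoothModuli :=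
  inferInstanceAs (TopologicalSpace (Quotient N.configurationSetoid))

/-- The quotient map from non-singular configurations to their classes. -/
def quotientMap (P : N.nonsingularConfigurations) : N.SmoothModuli :=
  Quotient.mk N.configurationSetoid P

/-- The oriented area as a function on the non-singular part of the configuration space. -/
def moduliArea : N.SmoothModuli → ℝ :=
  Quotient.lift (fun P : N.nonsingularConfigurations => orientedArea (P : PlanarPolygon N.n)) (by
    rintro P Q ⟨g, hg⟩
    rw [← orientedArea_smul g (Q : PlanarPolygon N.n)]
    exact congrArg orientedArea hg.symm)

/-- The necklace is realisable: `2 L_j < L₁ + … + L_k` for every `j` with `n_j = 1`. -/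
def Realisable : Prop :=
  ∀ j, N.count j = 1 → 2 * N.length j < ∑ i, N.length i

end Necklace

/-- The charts `c` make the subset `S` of the normed space `E` an (embedded) smooth submanifold of
dimension `d`: they form a smooth atlas on `S` (with the subspace topology) for which the inclusion
`S → E` is a smooth embedding. -/
def IsSmoothSubmanifold {E : Type} [NormedAddCommGroup E] [NormedSpace ℝ E] (S : Set E) (d : ℕ)
    (c : ChartedSpace (EuclideanSpace ℝ (Fin d)) S) : Prop :=
  IsManifold (𝓡 d) ∞ S ∧
    Manifold.IsSmoothEmbedding (𝓡 d) 𝓘(ℝ, E) ∞ (Subtype.val : S → E)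

/-- The charts `c` form a smooth atlas of dimension `d` on `M` for which `f : S → M` is a smooth
submersion. -/
def IsSubmersionStructure {S M : Type} [TopologicalSpace S] [TopologicalSpace M] {m : ℕ}
    [ChartedSpace (EuclideanSpace ℝ (Fin m)) S] (f : S → M) (d : ℕ)
    (c : ChartedSpace (EuclideanSpace ℝ (Fin d)) M) : Prop :=
  IsManifold (𝓡 d) ∞ M ∧ Manifold.IsSubmersion (𝓡 m) (𝓡 d) ∞ f

/-- The smooth structure (maximal smooth atlas) determined by the charts `c`. -/
def smoothStructure {M : Type} [TopologicalSpace M] {d : ℕ}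
    (c : ChartedSpace (EuclideanSpace ℝ (Fin d)) M) :
    Set (OpenPartialHomeomorph M (EuclideanSpace ℝ (Fin d))) :=
  IsManifold.maximalAtlas (𝓡 d) ∞ M

end

/-! The isometry group acts on polygons with an explicit global slice, so no general quotient
theorem is needed. The piece lengths are smooth where no side vanishes, and for `n ≥ 2` a vanishing
side creates a kink that destroys differentiability (`Necklace.mem_of_differentiableAt`).
Non-singular configurations are therefore a level set of a smooth submersion defined on the polygons
without zero sides at which the differential is onto.

The first side never vanishes, so each orbit contains exactly one polygon with its first vertex at
the origin and its second on the positive first half-axis. This normal form is smooth and invariant,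
and it embeds the quotient in `ℝ²ⁿ` (`Necklace.isEmbedding_moduliNormalForm`). The three normalising
conditions are independent of the piece lengths, because the latter are constant along orbits
(`Necklace.surjective_fderiv_normalDefect`). The inverse function theorem then gives charts around a
normal form. Adding the position of the first vertex and the slope of the first side gives charts
around every configuration, in which the quotient map is a linear projection.

Submersions have smooth local sections, so smoothness on the quotient can be tested upstairs. This
gives both the uniqueness of the structure and the smoothness of the area.

For existence, each piece is cut into equal sides. Realisability makes every side shorter than half
the perimeter unless `k = 1` and `n = 2`, and such sides close up to a non-collinear polygon
(`exists_unit_vectors`). A covector annihilating the image of the differential is a system of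
tensions in equilibrium, so tension times direction is the same vector for all sides;
non-collinearity forces it to vanish. In the exceptional case the segment traversed back and forth
is regular. -/

open scoped Manifold ContDiff

noncomputable section

/-! ### Slice charts -/

section SliceChart

open Set

variable {X E D A : Type*} [TopologicalSpace X] [NormedAddCommGroup E] [NormedAddCommGroup D]
  [NormedAddCommGroup A]

/-- If `Ψ` is a chart of `E` with values in a product in which the image of the embedding `j` is
the slice where the first component vanishes, the second component is a chart of `X`. -/
def sliceChart (j : X → E) (hj : Topology.IsEmbedding j) (Ψ : OpenPartialHomeomorph E (A × D))
    (hΨ : ∀ x ∈ Ψ.source, x ∈ range j ↔ (Ψ x).1 = 0) (x₀ : X) : OpenPartialHomeomorph X D :=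
  haveI : Nonempty X := ⟨x₀⟩
  have hr : ∀ z : D, (0, z) ∈ Ψ.target →
      j (Function.invFun j (Ψ.symm (0, z))) = Ψ.symm (0, z) := fun z hz =>
    Function.invFun_eq ((hΨ _ (Ψ.map_target hz)).2 (by rw [Ψ.right_inv hz]))
  have hl : ∀ x : X, j x ∈ Ψ.source → (0, (Ψ (j x)).2) = Ψ (j x) := fun x hx =>
    Prod.ext ((hΨ _ hx).1 (mem_range_self x)).symm rfl
  { toFun := fun x => (Ψ (j x)).2
    invFun := fun z => Function.invFun j (Ψ.symm (0, z))
    source := j ⁻¹' Ψ.source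
    target := {z | (0, z) ∈ Ψ.target}
    map_source' := fun x hx => by
      simp only [mem_ofPred_eq, hl x hx]
      exact Ψ.map_source hx
    map_target' := fun z hz => by
      simp only [mem_preimage, hr z hz]
      exact Ψ.map_target hz
    left_inv' := fun x hx => by
      rw [hl x hx, Ψ.left_inv hx]
      exact Function.leftInverse_invFun hj.injective x
    right_inv' := fun z hz => by
      simp only [hr z hz, Ψ.right_inv hz]
    open_source := Ψ.open_source.preimage hj.continuous
    open_target := Ψ.open_target.preimage (by fun_prop)
    continuousOn_toFun :=
      continuous_snd.comp_continuousOn (Ψ.continuousOn.comp hj.continuous.continuousOn fun _ hx => hx)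
    continuousOn_invFun := by
      rw [hj.continuousOn_iff]
      refine (Ψ.continuousOn_symm.comp (f := fun z : D => ((0, z) : A × D))
        (by fun_prop) fun z hz => hz).congr fun z hz => hr z hz }

variable {j : X → E} (hj : Topology.IsEmbedding j) (Ψ : OpenPartialHomeomorph E (A × D))
    (hΨ : ∀ x ∈ Ψ.source, x ∈ range j ↔ (Ψ x).1 = 0) (x₀ : X)

@[simp]
theorem sliceChart_source : (sliceChart j hj Ψ hΨ x₀).source = j ⁻¹' Ψ.source := rfl

theorem mem_sliceChart_target {z : D} :
    z ∈ (sliceChart j hj Ψ hΨ x₀).target ↔ (0, z) ∈ Ψ.target := Iff.rfl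

theorem sliceChart_symm {z : D} (hz : (0, z) ∈ Ψ.target) :
    j ((sliceChart j hj Ψ hΨ x₀).symm z) = Ψ.symm (0, z) :=
  haveI : Nonempty X := ⟨x₀⟩
  Function.invFun_eq ((hΨ _ (Ψ.map_target hz)).2 (by rw [Ψ.right_inv hz]))

end SliceChart

/-! ### Manifolds charted through a map to a normed space -/

section SmoothCharts

open Set

variable {X E D A : Type*} [TopologicalSpace X]
  [NormedAddCommGroup E] [NormedSpace ℝ E] [NormedAddCommGroup D] [NormedSpace ℝ D]
  [NormedAddCommGroup A] [NormedSpace ℝ A]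

/-- A chart of `X` is smooth along `j : X → E` if its inverse composed with `j` is smooth, and if
the chart itself is the restriction along `j` of a smooth map on an open subset of `E`. -/
structure IsSmoothChartAlong (j : X → E) (e : OpenPartialHomeomorph X D) : Prop where
  contDiffOn_symm : ContDiffOn ℝ ∞ (j ∘ e.symm) e.target
  exists_extension : ∃ (O : Set E) (K : E → D), IsOpen O ∧ ContDiffOn ℝ ∞ K O ∧
    MapsTo j e.source O ∧ ∀ x ∈ e.source, K (j x) = e x

/-- Going up by `j ∘ e.symm` and down by the smooth extension of `e'` shows why both clauses of
`IsSmoothChartAlong` are needed. -/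
theorem IsSmoothChartAlong.contDiffOn_transition {j : X → E} {e e' : OpenPartialHomeomorph X D}
    (he : IsSmoothChartAlong j e) (he' : IsSmoothChartAlong j e') :
    ContDiffOn ℝ ∞ (e.symm ≫ₕ e') (e.symm ≫ₕ e').source := by
  obtain ⟨O, K, -, hK, hO, hKe⟩ := he'.exists_extension
  have h : (e.symm ≫ₕ e').source ⊆ e.target := fun z hz => by simp at hz; exact hz.1
  have h' : ∀ z ∈ (e.symm ≫ₕ e').source, e.symm z ∈ e'.source := fun z hz => by
    simp at hz; exact hz.2
  refine (hK.comp (he.contDiffOn_symm.mono h) fun z hz => hO (h' z hz)).congr fun z hz => ?_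
  exact (hKe _ (h' z hz)).symm

/-- The charted space structure whose atlas consists of all charts that are smooth along `j`. -/
abbrev chartedSpaceAlong (j : X → E)
    (h : ∀ x, ∃ e : OpenPartialHomeomorph X D, x ∈ e.source ∧ IsSmoothChartAlong j e) :
    ChartedSpace D X where
  atlas := {e | IsSmoothChartAlong j e}
  chartAt x := (h x).choose
  mem_chart_source x := (h x).choose_spec.1
  chart_mem_atlas x := (h x).choose_spec.2

variable {j : X → E}
  (h : ∀ x, ∃ e : OpenPartialHomeomorph X D, x ∈ e.source ∧ IsSmoothChartAlong j e)

theorem isManifold_chartedSpaceAlong :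
    letI := chartedSpaceAlong j h
    IsManifold 𝓘(ℝ, D) ∞ X := by
  let _ := chartedSpaceAlong j h
  refine isManifold_of_contDiffOn _ _ _ fun e e' he he' => ?_
  simpa using IsSmoothChartAlong.contDiffOn_transition he he'

theorem IsSmoothChartAlong.mem_maximalAtlas {e : OpenPartialHomeomorph X D}
    (he : IsSmoothChartAlong j e) :
    letI := chartedSpaceAlong j h
    e ∈ IsManifold.maximalAtlas 𝓘(ℝ, D) ∞ X := by
  let _ := chartedSpaceAlong j h
  have := isManifold_chartedSpaceAlong h
  exact IsManifold.subset_maximalAtlas he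

theorem contMDiff_chartedSpaceAlong :
    letI := chartedSpaceAlong j h
    ContMDiff 𝓘(ℝ, D) 𝓘(ℝ, E) ∞ j := by
  let _ := chartedSpaceAlong j h
  have := isManifold_chartedSpaceAlong h
  intro x
  obtain ⟨e, hx, he⟩ := h x
  have h1 : ContMDiffOn 𝓘(ℝ, D) 𝓘(ℝ, D) ∞ e e.source :=
    contMDiffOn_of_mem_maximalAtlas (he.mem_maximalAtlas h)
  have h2 : ContMDiffOn 𝓘(ℝ, D) 𝓘(ℝ, E) ∞ ((j ∘ e.symm) ∘ e) e.source :=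
    he.contDiffOn_symm.contMDiffOn.comp h1 fun y hy => e.map_source hy
  refine (h2.congr fun y hy => ?_).contMDiffAt (e.open_source.mem_nhds hx)
  simp [e.left_inv hy]

section

variable (hj : Topology.IsEmbedding j) (Ψ : OpenPartialHomeomorph E (A × D))
    (hΨ : ∀ x ∈ Ψ.source, x ∈ range j ↔ (Ψ x).1 = 0) (x₀ : X)

theorem isSmoothChartAlong_sliceChart (h1 : ContDiffOn ℝ ∞ Ψ Ψ.source)
    (h2 : ContDiffOn ℝ ∞ Ψ.symm Ψ.target) :
    IsSmoothChartAlong j (sliceChart j hj Ψ hΨ x₀) where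
  contDiffOn_symm := by
    refine (h2.comp (f := fun z : D => ((0, z) : A × D)) (by fun_prop) fun z hz => hz).congr
      fun z hz => sliceChart_symm hj Ψ hΨ x₀ hz
  exists_extension := ⟨Ψ.source, fun x => (Ψ x).2, Ψ.open_source, h1.snd, fun _ hx => hx,
    fun _ _ => rfl⟩

/-- In the slice chart and in `Ψ` the map `j` is the inclusion of a factor. The equivalence `T` only
carries the product back to the model space `E`, so any choice works. -/
theorem isImmersionAtOfComplement_chartedSpaceAlong (hj : Topology.IsEmbedding j)
    (Ψ : OpenPartialHomeomorph E (A × D)) (hΨ : ∀ x ∈ Ψ.source, x ∈ range j ↔ (Ψ x).1 = 0) (x₀ : X)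
    (h1 : ContDiffOn ℝ ∞ Ψ Ψ.source)
    (h2 : ContDiffOn ℝ ∞ Ψ.symm Ψ.target) (T : (D × A) ≃L[ℝ] E) (hx₀ : j x₀ ∈ Ψ.source) :
    letI := chartedSpaceAlong j h
    Manifold.IsImmersionAtOfComplement A 𝓘(ℝ, D) 𝓘(ℝ, E) ∞ j x₀ := by
  let _ := chartedSpaceAlong j h
  -- The slice is the second factor for `Ψ`, whereas the immersion normal form puts the domain
  -- first.
  let S : (A × D) ≃L[ℝ] E := (ContinuousLinearEquiv.prodComm ℝ A D).trans T
  refine Manifold.IsImmersionAtOfComplement.mk_of_continuousAt hj.continuous.continuousAt T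
    (sliceChart j hj Ψ hΨ x₀) (Ψ ≫ₕ S.toHomeomorph.toOpenPartialHomeomorph) hx₀ (by simpa using hx₀)
    ((isSmoothChartAlong_sliceChart hj Ψ hΨ x₀ h1 h2).mem_maximalAtlas h) ?_ ?_
  · refine OpenPartialHomeomorph.mem_maximalAtlas_of_contMDiffOn _ ?_ ?_
    · refine (S.contDiff.comp_contDiffOn h1).contMDiffOn.mono ?_
      simp
    · refine ContDiffOn.contMDiffOn ?_
      refine h2.comp S.symm.contDiff.contDiffOn ?_
      intro z hz
      simpa using hz
  · intro z hz
    replace hz : (0, z) ∈ Ψ.target := by simpa [mem_sliceChart_target] using hz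
    simp only [mfld_simps, Function.comp_apply]
    rw [sliceChart_symm hj Ψ hΨ x₀ hz]
    simp [S, Ψ.right_inv hz]

end

end SmoothCharts

/-! ### Descent along submersions -/

section Descent

open Manifold

variable {E E' E'' : Type} [NormedAddCommGroup E] [NormedSpace ℝ E]
  [NormedAddCommGroup E'] [NormedSpace ℝ E'] [NormedAddCommGroup E''] [NormedSpace ℝ E'']
  {S M N : Type*} [TopologicalSpace S] [ChartedSpace E S] [TopologicalSpace M] [ChartedSpace E' M]
  [TopologicalSpace N] [ChartedSpace E'' N] {q : S → M} {f : M → N}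

/-- A submersion has a smooth local section through each point. -/
theorem Manifold.IsSubmersionAt.exists_section {x : S}
    (h : IsSubmersionAt 𝓘(ℝ, E) 𝓘(ℝ, E') ∞ q x) :
    ∃ σ : M → S, ContMDiffAt 𝓘(ℝ, E') 𝓘(ℝ, E) ∞ σ (q x) ∧ σ (q x) = x ∧
      ∀ᶠ m in nhds (q x), q (σ m) = m := by
  set φ := h.domChart with hφ
  set ψ := h.codChart with hψ
  have hx : x ∈ φ.source := h.mem_domChart_source
  have hqx : q x ∈ ψ.source := h.mem_codChart_source
  -- The section freezes the fibre coordinate at its value at `x`.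
  let k : E' → E := fun y => h.equiv.symm (y, (h.equiv (φ x)).2)
  have hk : ContDiff ℝ ∞ k := h.equiv.symm.contDiff.comp (by fun_prop)
  have hw : ∀ z ∈ φ.target, ψ (q (φ.symm z)) = (h.equiv z).1 := fun z hz => by
    have hw := h.writtenInCharts
    have := hw (show z ∈ (φ.extend 𝓘(ℝ, E)).target by simpa using hz)
    simpa using this
  have hkx : k (ψ (q x)) = φ x := by
    have := hw (φ x) (φ.map_source hx)
    rw [φ.left_inv hx] at this
    simp [k, this]
  have hψc : ContMDiffAt 𝓘(ℝ, E') 𝓘(ℝ, E') ∞ ψ (q x) :=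
    contMDiffAt_of_mem_maximalAtlas h.codChart_mem_maximalAtlas hqx
  have hkψ : ContMDiffAt 𝓘(ℝ, E') 𝓘(ℝ, E) ∞ (k ∘ ψ) (q x) := hk.contMDiff.contMDiffAt.comp _ hψc
  have hφc : ContMDiffAt 𝓘(ℝ, E) 𝓘(ℝ, E) ∞ φ.symm (k (ψ (q x))) :=
    contMDiffAt_symm_of_mem_maximalAtlas h.domChart_mem_maximalAtlas (hkx ▸ φ.map_source hx)
  refine ⟨φ.symm ∘ k ∘ ψ, ContMDiffAt.comp (q x) hφc hkψ, by simp [hkx, φ.left_inv hx], ?_⟩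
  have h1 : ∀ᶠ m in nhds (q x), k (ψ m) ∈ φ.target :=
    hkψ.continuousAt.eventually_mem (φ.open_target.mem_nhds (by simp [hkx, φ.map_source hx]))
  filter_upwards [h1, ψ.open_source.mem_nhds hqx] with m hm hm'
  have hq : q (φ.symm (k (ψ m))) ∈ ψ.source := h.source_subset_preimage_source (φ.map_target hm)
  apply ψ.injOn hq hm'
  rw [hw _ hm]
  simp [k]

/-- A function on the base of a surjective submersion is smooth if its pullback is. -/
theorem Manifold.IsSubmersion.contMDiff_of_comp (hq : IsSubmersion 𝓘(ℝ, E) 𝓘(ℝ, E') ∞ q)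
    (hs : Function.Surjective q) (hf : ContMDiff 𝓘(ℝ, E) 𝓘(ℝ, E'') ∞ (f ∘ q)) :
    ContMDiff 𝓘(ℝ, E') 𝓘(ℝ, E'') ∞ f := by
  intro m
  obtain ⟨x, rfl⟩ := hs m
  obtain ⟨σ, hσ, hσx, hqσ⟩ := (hq.isSubmersionAt x).exists_section
  have h : ContMDiffAt 𝓘(ℝ, E') 𝓘(ℝ, E'') ∞ ((f ∘ q) ∘ σ) (q x) := hf.contMDiffAt.comp _ hσ
  refine h.congr_of_eventuallyEq ?_
  filter_upwards [hqσ] with m hm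
  simp [hm]

/-- Membership in a maximal atlas means that the chart and its inverse are smooth, and both
properties survive composition with a smooth identity map. -/
theorem maximalAtlas_subset_of_contMDiff_id {M : Type*} [TopologicalSpace M]
    (c c' : ChartedSpace E M) (hc : @IsManifold ℝ _ E _ _ E _ 𝓘(ℝ, E) ∞ M _ c)
    (hc' : @IsManifold ℝ _ E _ _ E _ 𝓘(ℝ, E) ∞ M _ c')
    (h : @ContMDiff ℝ _ E _ _ E _ 𝓘(ℝ, E) M _ c E _ _ E _ 𝓘(ℝ, E) M _ c' ∞ id)
    (h' : @ContMDiff ℝ _ E _ _ E _ 𝓘(ℝ, E) M _ c' E _ _ E _ 𝓘(ℝ, E) M _ c ∞ id) :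
    @IsManifold.maximalAtlas ℝ _ E _ _ E _ 𝓘(ℝ, E) ∞ M _ c' ⊆
      @IsManifold.maximalAtlas ℝ _ E _ _ E _ 𝓘(ℝ, E) ∞ M _ c := by
  intro e he
  rw [@IsManifold.mem_maximalAtlas_iff_contMDiffOn] at he ⊢
  refine ⟨?_, ?_⟩
  · exact @ContMDiffOn.comp ℝ _ E _ _ E _ 𝓘(ℝ, E) M _ E _ _ E _ 𝓘(ℝ, E) M _ E _ _ E _ 𝓘(ℝ, E) E _
      c c' _ id e.source ∞ e.source e he.1
      (@ContMDiff.contMDiffOn ℝ _ E _ _ E _ 𝓘(ℝ, E) M _ c E _ _ E _ 𝓘(ℝ, E) M _ c' id e.source ∞ h)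
      fun x hx => hx
  · exact @ContMDiff.comp_contMDiffOn ℝ _ E _ _ E _ 𝓘(ℝ, E) E _ E _ _ E _ 𝓘(ℝ, E) M _ E _ _ E _
      𝓘(ℝ, E) M _ _ c' c ∞ e.symm id e.target h' he.2

/-- Two smooth structures for which the same surjective map is a submersion coincide. -/
theorem maximalAtlas_eq_of_isSubmersion {M : Type*} [TopologicalSpace M] {q : S → M}
    (hs : Function.Surjective q) (c c' : ChartedSpace E' M)
    (hc : @IsManifold ℝ _ E' _ _ E' _ 𝓘(ℝ, E') ∞ M _ c)
    (hc' : @IsManifold ℝ _ E' _ _ E' _ 𝓘(ℝ, E') ∞ M _ c')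
    (h : letI := c; IsSubmersion 𝓘(ℝ, E) 𝓘(ℝ, E') ∞ q)
    (h' : letI := c'; IsSubmersion 𝓘(ℝ, E) 𝓘(ℝ, E') ∞ q) :
    @IsManifold.maximalAtlas ℝ _ E' _ _ E' _ 𝓘(ℝ, E') ∞ M _ c =
      @IsManifold.maximalAtlas ℝ _ E' _ _ E' _ 𝓘(ℝ, E') ∞ M _ c' := by
  have k := @IsSubmersion.contMDiff _ _ _ _ _ _ _ _ _ _ _ _ _ _ _ _ _ _ _ c _ _ h
  have k' := @IsSubmersion.contMDiff _ _ _ _ _ _ _ _ _ _ _ _ _ _ _ _ _ _ _ c' _ _ h'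
  -- The pullback of the identity along `q` is `q` itself, which is smooth for either structure.
  have i := @IsSubmersion.contMDiff_of_comp E E' E' _ _ _ _ _ _ S M M _ _ _ c _ c' q id h hs k'
  have i' := @IsSubmersion.contMDiff_of_comp E E' E' _ _ _ _ _ _ S M M _ _ _ c' _ c q id h' hs k
  exact (maximalAtlas_subset_of_contMDiff_id c' c hc' hc i' i).antisymm
    (maximalAtlas_subset_of_contMDiff_id c c' hc hc' i i')

end Descent

/-! ### Rigid motions in coordinates -/

namespace Plane

/-- Complex multiplication in the plane. -/
def rotate (u x : Plane) : Plane := !₂[u 0 * x 0 - u 1 * x 1, u 0 * x 1 + u 1 * x 0]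

/-- Complex conjugation in the plane. -/
def conj (u : Plane) : Plane := !₂[u 0, -u 1]

@[simp] theorem rotate_apply_zero (u x : Plane) : rotate u x 0 = u 0 * x 0 - u 1 * x 1 := rfl
@[simp] theorem rotate_apply_one (u x : Plane) : rotate u x 1 = u 0 * x 1 + u 1 * x 0 := rfl
@[simp] theorem conj_apply_zero (u : Plane) : conj u 0 = u 0 := rfl
@[simp] theorem conj_apply_one (u : Plane) : conj u 1 = -u 1 := rfl

theorem ext_coord {x y : Plane} (h0 : x 0 = y 0) (h1 : x 1 = y 1) : x = y := by
  ext i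
  fin_cases i
  exacts [h0, h1]

theorem norm_sq_eq (x : Plane) : ‖x‖ ^ 2 = x 0 ^ 2 + x 1 ^ 2 := by
  simp [EuclideanSpace.real_norm_sq_eq, Fin.sum_univ_two]

theorem rotate_conj_rotate {u : Plane} (hu : u 0 ^ 2 + u 1 ^ 2 = 1) (x : Plane) :
    rotate (conj u) (rotate u x) = x := by
  apply ext_coord <;> simp
  · linear_combination x 0 * hu
  · linear_combination x 1 * hu

theorem rotate_rotate_conj {u : Plane} (hu : u 0 ^ 2 + u 1 ^ 2 = 1) (x : Plane) :
    rotate u (rotate (conj u) x) = x := by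
  apply ext_coord <;> simp
  · linear_combination x 0 * hu
  · linear_combination x 1 * hu

theorem norm_rotate {u : Plane} (hu : u 0 ^ 2 + u 1 ^ 2 = 1) (x : Plane) :
    ‖rotate u x‖ = ‖x‖ := by
  rw [← sq_eq_sq₀ (norm_nonneg _) (norm_nonneg _), norm_sq_eq, norm_sq_eq]
  simp
  linear_combination (x 0 ^ 2 + x 1 ^ 2) * hu

theorem contDiff_iff {F : Type*} [NormedAddCommGroup F] [NormedSpace ℝ F] {s : Set F}
    {f : F → Plane} : ContDiffOn ℝ ∞ f s ↔
      ContDiffOn ℝ ∞ (fun x => f x 0) s ∧ ContDiffOn ℝ ∞ (fun x => f x 1) s := by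
  rw [contDiffOn_euclidean, Fin.forall_fin_two]

end Plane

theorem ContDiffOn.plane_rotate {F : Type*} [NormedAddCommGroup F] [NormedSpace ℝ F] {s : Set F}
    {f g : F → Plane} (hf : ContDiffOn ℝ ∞ f s) (hg : ContDiffOn ℝ ∞ g s) :
    ContDiffOn ℝ ∞ (fun x => Plane.rotate (f x) (g x)) s := by
  rw [Plane.contDiff_iff] at *
  exact ⟨(hf.1.mul hg.1).sub (hf.2.mul hg.2), (hf.1.mul hg.2).add (hf.2.mul hg.1)⟩

theorem ContDiffOn.plane_conj {F : Type*} [NormedAddCommGroup F] [NormedSpace ℝ F] {s : Set F}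
    {f : F → Plane} (hf : ContDiffOn ℝ ∞ f s) : ContDiffOn ℝ ∞ (fun x => Plane.conj (f x)) s := by
  rw [Plane.contDiff_iff] at *
  exact ⟨hf.1, hf.2.neg⟩

open Plane

/-- Rotations followed by translations are orientation-preserving isometries. -/
theorem IsomPlus.exists_smul_eq (u p : Plane) (hu : u 0 ^ 2 + u 1 ^ 2 = 1) :
    ∃ g : IsomPlus, ∀ x : Plane, g • x = rotate u x + p := by
  let L : Plane ≃ₗ[ℝ] Plane :=
    { toFun := rotate u
      invFun := rotate (conj u)
      map_add' := fun x y => by apply ext_coord <;> simp <;> ring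
      map_smul' := fun c x => by apply ext_coord <;> simp <;> ring
      left_inv := rotate_conj_rotate hu
      right_inv := rotate_rotate_conj hu }
  let Li : Plane ≃ₗᵢ[ℝ] Plane := ⟨L, norm_rotate hu⟩
  let g : Plane ≃ᵃⁱ[ℝ] Plane :=
    Li.toAffineIsometryEquiv.trans (AffineIsometryEquiv.vaddConst ℝ p)
  have hdet : LinearMap.det (L : Plane →ₗ[ℝ] Plane) = 1 := by
    rw [← LinearMap.det_toMatrix (EuclideanSpace.basisFun (Fin 2) ℝ).toBasis,
      Matrix.det_fin_two]
    simp [LinearMap.toMatrix_apply, L]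
    linear_combination hu
  refine ⟨⟨g, ?_⟩, fun x => ?_⟩
  · change 0 < LinearMap.det (L : Plane →ₗ[ℝ] Plane)
    rw [hdet]
    exact one_pos
  · rfl

/-- Orientation-preserving isometries are rotations followed by translations. -/
theorem IsomPlus.exists_rotate (g : IsomPlus) :
    ∃ u p : Plane, u 0 ^ 2 + u 1 ^ 2 = 1 ∧ ∀ x : Plane, g • x = rotate u x + p := by
  obtain ⟨a, b, c, d, s, t, hdet, hg⟩ := IsomPlus.exists_matrix g
  have hiso : ∀ x : Plane, (a * x 0 + b * x 1) ^ 2 + (c * x 0 + d * x 1) ^ 2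
      = x 0 ^ 2 + x 1 ^ 2 := fun x => by
    have h : dist (g • x) (g • (0 : Plane)) = dist x 0 :=
      (g : Plane ≃ᵃⁱ[ℝ] Plane).dist_map x 0
    rw [dist_eq_norm, dist_zero_right, ← sq_eq_sq₀ (norm_nonneg _) (norm_nonneg _), norm_sq_eq,
      norm_sq_eq] at h
    simp only [PiLp.sub_apply, hg, PiLp.zero_apply] at h
    linear_combination h
  -- Testing the isometry on the basis vectors and on their sum makes the columns orthonormal;
  -- determinant `1` then leaves only rotations.
  have h1 : a ^ 2 + c ^ 2 = 1 := by simpa using hiso !₂[1, 0]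
  have h2 : b ^ 2 + d ^ 2 = 1 := by simpa using hiso !₂[0, 1]
  have h3 : (a + b) ^ 2 + (c + d) ^ 2 = 2 := by
    have := hiso !₂[1, 1]
    simp at this
    linarith
  have h4 : a * b + c * d = 0 := by linarith
  have hd : d = a := by linear_combination (-d) * h1 + a * hdet + c * h4
  have hb : b = -c := by linear_combination (-b) * h1 + a * h4 - c * hdet
  refine ⟨!₂[a, c], !₂[s, t], by simpa using h1, fun x => ext_coord ?_ ?_⟩
  · simp [(hg x).1, hb]
    ring
  · simp [(hg x).2, hd]
    ring

/-! ### Normal forms of polygons -/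

section NormalForm

variable {n : ℕ} (i j : Fin n)

/-- The unit vector from the `i`-th to the `j`-th vertex. -/
def direction (P : PlanarPolygon n) : Plane := ‖P j - P i‖⁻¹ • (P j - P i)

/-- The polygon moved so that its `i`-th vertex is the origin and its `j`-th vertex lies on the
positive part of the first axis. -/
def normalForm (P : PlanarPolygon n) : PlanarPolygon n :=
  fun l => rotate (conj (direction i j P)) (P l - P i)

/-- The `i`-th vertex is the origin and the `j`-th vertex lies on the positive first half-axis. -/
def IsNormal (P : PlanarPolygon n) : Prop := P i = 0 ∧ P j 1 = 0 ∧ 0 < P j 0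

variable {i j}

theorem normSq_direction {P : PlanarPolygon n} (h : P i ≠ P j) :
    direction i j P 0 ^ 2 + direction i j P 1 ^ 2 = 1 := by
  have h0 : ‖P j - P i‖ ≠ 0 := norm_ne_zero_iff.2 (sub_ne_zero.2 h.symm)
  rw [← norm_sq_eq, direction, norm_smul, norm_inv, norm_norm, inv_mul_cancel₀ h0, one_pow]

theorem IsNormal.ne {w : PlanarPolygon n} (hw : IsNormal i j w) : w i ≠ w j := by
  intro h
  have := hw.2.2
  rw [← h, hw.1] at this
  simp at this

theorem isNormal_normalForm {P : PlanarPolygon n} (h : P i ≠ P j) :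
    IsNormal i j (normalForm i j P) := by
  have h0 : 0 < ‖P j - P i‖ := norm_pos_iff.2 (sub_ne_zero.2 h.symm)
  have h2 := norm_sq_eq (P j - P i)
  refine ⟨?_, ?_, ?_⟩
  · apply ext_coord <;> simp [normalForm]
  · simp [normalForm, direction]
    ring
  · have : normalForm i j P j 0 = ‖P j - P i‖ := by
      simp [normalForm, direction] at h2 ⊢
      field_simp
      linear_combination -h2
    rwa [this]

theorem rotate_normalForm {P : PlanarPolygon n} (h : P i ≠ P j) (l : Fin n) :
    rotate (direction i j P) (normalForm i j P l) + P i = P l := by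
  rw [normalForm, rotate_rotate_conj (normSq_direction h), sub_add_cancel]

theorem IsNormal.direction_eq {w : PlanarPolygon n} (hw : IsNormal i j w) {u : Plane}
    (hu : u 0 ^ 2 + u 1 ^ 2 = 1) (p : Plane) :
    direction i j (fun l => rotate u (w l) + p) = u := by
  have h : ‖w j‖ = w j 0 := by
    rw [← sq_eq_sq₀ (norm_nonneg _) hw.2.2.le, norm_sq_eq, hw.2.1]
    ring
  have h' := hw.2.2.ne'
  have he : rotate u (w j) + p - (rotate u (w i) + p) = rotate u (w j) := by
    rw [hw.1]
    apply ext_coord <;> simp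
  rw [direction, he, norm_rotate hu, h]
  apply ext_coord <;> simp [hw.2.1] <;> field_simp

/-- The direction from vertex `i` to vertex `j` reads off the rotation and vertex `i` the
translation, so both can be undone. Hence an orbit meets the slice at most once. -/
theorem IsNormal.normalForm_eq {w : PlanarPolygon n} (hw : IsNormal i j w) {u : Plane}
    (hu : u 0 ^ 2 + u 1 ^ 2 = 1) (p : Plane) :
    normalForm i j (fun l => rotate u (w l) + p) = w := by
  funext l
  have he : rotate u (w l) + p - (rotate u (w i) + p) = rotate u (w l) := by
    rw [hw.1]
    apply ext_coord <;> simp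
  rw [normalForm, hw.direction_eq hu, he, rotate_conj_rotate hu]

theorem IsNormal.normalForm_self {w : PlanarPolygon n} (hw : IsNormal i j w) :
    normalForm i j w = w := by
  have h := hw.normalForm_eq (u := !₂[1, 0]) (by simp) 0
  have h' : (fun l => rotate !₂[1, 0] (w l) + 0) = w := by
    funext l
    apply ext_coord <;> simp
  rwa [h'] at h

theorem exists_smul_normalForm {P : PlanarPolygon n} (h : P i ≠ P j) :
    ∃ g : IsomPlus, g • normalForm i j P = P := by
  obtain ⟨g, hg⟩ := IsomPlus.exists_smul_eq _ (P i) (normSq_direction h)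
  refine ⟨g, funext fun l => ?_⟩
  rw [Pi.smul_apply, hg, rotate_normalForm h]

theorem normalForm_smul {P : PlanarPolygon n} (h : P i ≠ P j) (g : IsomPlus) :
    normalForm i j (g • P) = normalForm i j P := by
  obtain ⟨k, hk⟩ := exists_smul_normalForm h
  obtain ⟨u, p, hu, hg⟩ := IsomPlus.exists_rotate (g * k)
  have : g • P = fun l => rotate u (normalForm i j P l) + p := by
    funext l
    rw [← hg, mul_smul, Pi.smul_apply]
    exact congrArg (g • ·) (congrFun hk l).symm
  rw [this, (isNormal_normalForm h).normalForm_eq hu]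

theorem contDiffOn_direction :
    ContDiffOn ℝ ∞ (direction i j) {P : PlanarPolygon n | P i ≠ P j} := by
  have h : ContDiff ℝ ∞ fun P : PlanarPolygon n => P j - P i := by fun_prop
  have h' : ∀ P ∈ {P : PlanarPolygon n | P i ≠ P j}, P j - P i ≠ 0 := fun P hP =>
    sub_ne_zero.2 (Ne.symm hP)
  exact ((h.contDiffOn.norm ℝ h').inv fun P hP => norm_ne_zero_iff.2 (h' P hP)).smul h.contDiffOn

theorem contDiffOn_normalForm :
    ContDiffOn ℝ ∞ (normalForm i j) {P : PlanarPolygon n | P i ≠ P j} := by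
  rw [contDiffOn_pi]
  intro l
  exact contDiffOn_direction.plane_conj.plane_rotate (by fun_prop)

theorem isOpen_setOf_vertex_ne : IsOpen {P : PlanarPolygon n | P i ≠ P j} :=
  isOpen_ne_fun (continuous_apply i) (continuous_apply j)

/-! ### Slopes as coordinates for directions -/

variable (i j) in
/-- The inner product of `v` with the vector from the `i`-th to the `j`-th vertex. -/
def forward (v : Plane) (P : PlanarPolygon n) : ℝ :=
  v 0 * (P j - P i) 0 + v 1 * (P j - P i) 1

variable (i j) in
/-- The slope, relative to `v`, of the line through the `i`-th and the `j`-th vertex. -/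
def sideSlope (v : Plane) (P : PlanarPolygon n) : ℝ :=
  (v 0 * (P j - P i) 1 - v 1 * (P j - P i) 0) / forward i j v P

/-- The unit vector of given slope relative to `v`. -/
def slopeDirection (v : Plane) (τ : ℝ) : Plane :=
  ‖v + τ • rotate !₂[0, 1] v‖⁻¹ • (v + τ • rotate !₂[0, 1] v)

theorem slopeVector_ne_zero {v : Plane} (hv : v ≠ 0) (τ : ℝ) :
    v + τ • rotate !₂[0, 1] v ≠ 0 := by
  intro h
  have h0 : v 0 - τ * v 1 = 0 := by simpa [sub_eq_add_neg] using congrArg (fun x : Plane => x 0) h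
  have h1 : v 1 + τ * v 0 = 0 := by simpa using congrArg (fun x : Plane => x 1) h
  have h2 : v 0 ^ 2 + v 1 ^ 2 = 0 := by linear_combination v 0 * h0 + v 1 * h1
  rw [← norm_sq_eq] at h2
  exact hv (by simpa using h2)

theorem normSq_slopeDirection {v : Plane} (hv : v ≠ 0) (τ : ℝ) :
    slopeDirection v τ 0 ^ 2 + slopeDirection v τ 1 ^ 2 = 1 := by
  have h0 := norm_ne_zero_iff.2 (slopeVector_ne_zero hv τ)
  rw [← norm_sq_eq, slopeDirection, norm_smul, norm_inv, norm_norm, inv_mul_cancel₀ h0, one_pow]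

theorem contDiff_slopeDirection {v : Plane} (hv : v ≠ 0) : ContDiff ℝ ∞ (slopeDirection v) := by
  have h : ContDiff ℝ ∞ fun τ : ℝ => v + τ • rotate !₂[0, 1] v := by fun_prop
  exact ((h.norm ℝ (slopeVector_ne_zero hv)).inv fun τ =>
    norm_ne_zero_iff.2 (slopeVector_ne_zero hv τ)).smul h

theorem ne_of_forward_pos {v : Plane} {P : PlanarPolygon n} (h : 0 < forward i j v P) :
    P i ≠ P j := by
  intro h'
  simp [forward, h'] at h

/-- A vector in the open half-plane facing `v` is a positive multiple of `v + τ • rotate !₂[0, 1]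
v`, with `τ` its slope. The slope is thus a global coordinate on an open half-circle of directions.
-/
theorem slopeDirection_sideSlope {v : Plane} {P : PlanarPolygon n} (h : 0 < forward i j v P) :
    slopeDirection v (sideSlope i j v P) = direction i j P := by
  have hv : 0 < v 0 ^ 2 + v 1 ^ 2 := by
    by_contra h'
    have h0 : v 0 = 0 := by nlinarith [sq_nonneg (v 0), sq_nonneg (v 1)]
    have h1 : v 1 = 0 := by nlinarith [sq_nonneg (v 0), sq_nonneg (v 1)]
    simp [forward, h0, h1] at h
  have key : P j - P i = (forward i j v P / (v 0 ^ 2 + v 1 ^ 2)) •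
      (v + sideSlope i j v P • rotate !₂[0, 1] v) := by
    have h' := h.ne'
    apply ext_coord <;> simp [sideSlope] <;> field_simp <;> simp [forward] <;> ring
  have hc : 0 < forward i j v P / (v 0 ^ 2 + v 1 ^ 2) := by positivity
  rw [direction, key, slopeDirection, norm_smul, mul_inv, smul_smul, Real.norm_of_nonneg hc.le]
  congr 1
  field_simp

theorem IsNormal.forward_rotate {w : PlanarPolygon n} (hw : IsNormal i j w) (u p v : Plane) :
    forward i j v (fun l => rotate u (w l) + p) = w j 0 * (v 0 * u 0 + v 1 * u 1) := by
  simp [forward, hw.1, hw.2.1]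
  ring

theorem IsNormal.forward_slopeDirection {w : PlanarPolygon n} (hw : IsNormal i j w) {v : Plane}
    (hv : v ≠ 0) (τ : ℝ) (p : Plane) :
    0 < forward i j v (fun l => rotate (slopeDirection v τ) (w l) + p) := by
  rw [hw.forward_rotate]
  refine mul_pos hw.2.2 ?_
  have h0 := norm_pos_iff.2 (slopeVector_ne_zero hv τ)
  have h1 : v 0 * slopeDirection v τ 0 + v 1 * slopeDirection v τ 1
      = ‖v + τ • rotate !₂[0, 1] v‖⁻¹ * ‖v‖ ^ 2 := by
    rw [norm_sq_eq v]
    simp [slopeDirection]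
    ring
  have := norm_pos_iff.2 hv
  rw [h1]
  positivity

theorem IsNormal.sideSlope_slopeDirection {w : PlanarPolygon n} (hw : IsNormal i j w) {v : Plane}
    (hv : v ≠ 0) (τ : ℝ) (p : Plane) :
    sideSlope i j v (fun l => rotate (slopeDirection v τ) (w l) + p) = τ := by
  have h := hw.forward_slopeDirection hv τ p
  rw [sideSlope, div_eq_iff h.ne']
  simp [forward, hw.1, hw.2.1, slopeDirection]
  ring

theorem continuous_forward (v : Plane) : Continuous (forward (n := n) i j v) := by
  unfold forward
  fun_prop

theorem contDiffOn_sideSlope (v : Plane) :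
    ContDiffOn ℝ ∞ (sideSlope i j v) {P : PlanarPolygon n | 0 < forward i j v P} := by
  unfold sideSlope
  refine ContDiffOn.div ?_ ?_ fun P hP => ne_of_gt hP
  · fun_prop
  · unfold forward
    fun_prop

end NormalForm

/-! ### Completing a submersion to a local diffeomorphism -/

section LocalDiffeo

variable {E B D : Type*} [NormedAddCommGroup E] [NormedSpace ℝ E] [FiniteDimensional ℝ E]
  [NormedAddCommGroup B] [NormedSpace ℝ B] [FiniteDimensional ℝ B]
  [NormedAddCommGroup D] [NormedSpace ℝ D] [FiniteDimensional ℝ D]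

/-- Take for `π` a projection onto the kernel of `f`, identified with `D` by dimension: then `f` and
`π` have no common kernel. -/
theorem exists_continuousLinearEquiv_prod (f : E →L[ℝ] B)
    (hf : Function.Surjective f)
    (hdim : Module.finrank ℝ E = Module.finrank ℝ B + Module.finrank ℝ D) :
    ∃ (π : E →L[ℝ] D) (T : E ≃L[ℝ] B × D), (T : E →L[ℝ] B × D) = f.prod π := by
  have hrank := LinearMap.finrank_range_add_finrank_ker (f : E →ₗ[ℝ] B)
  rw [LinearMap.range_eq_top.2 hf, finrank_top] at hrank
  have hker : Module.finrank ℝ (LinearMap.ker (f : E →ₗ[ℝ] B)) = Module.finrank ℝ D := by omega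
  let e := LinearEquiv.ofFinrankEq _ _ hker
  obtain ⟨p, hp⟩ := (LinearMap.ker (f : E →ₗ[ℝ] B)).exists_isCompl
  let pr := Submodule.projectionOnto _ _ hp
  let π : E →L[ℝ] D := LinearMap.toContinuousLinearMap (e.toLinearMap ∘ₗ pr)
  have hinj : Function.Injective (f.prod π).toLinearMap := by
    rw [← LinearMap.ker_eq_bot, LinearMap.ker_eq_bot']
    intro x hx
    have h1 : f x = 0 := congrArg Prod.fst hx
    have h2 : e (pr x) = 0 := congrArg Prod.snd hx
    have h3 : pr x = 0 := by simpa using h2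
    have h4 := Submodule.projectionOnto_apply_left hp ⟨x, h1⟩
    have h5 : pr x = ⟨x, h1⟩ := h4
    rw [h3] at h5
    exact (congrArg Subtype.val h5).symm
  have hd : Module.finrank ℝ E = Module.finrank ℝ (B × D) := by
    rw [Module.finrank_prod, hdim]
  refine ⟨π, (LinearEquiv.ofInjectiveOfFinrankEq _ hinj hd).toContinuousLinearEquiv, ?_⟩
  ext x <;> rfl

/-- This is the inverse function theorem for `(f, π)`, with `π` as in
`exists_continuousLinearEquiv_prod`. -/
theorem exists_openPartialHomeomorph_prod {f : E → B} {U : Set E} (hU : IsOpen U)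
    (hf : ContDiffOn ℝ ∞ f U) {a : E} (ha : a ∈ U) (hsurj : Function.Surjective (fderiv ℝ f a))
    (hdim : Module.finrank ℝ E = Module.finrank ℝ B + Module.finrank ℝ D) :
    ∃ (π : E →L[ℝ] D) (Ψ : OpenPartialHomeomorph E (B × D)), a ∈ Ψ.source ∧ Ψ.source ⊆ U ∧
      (∀ x, Ψ x = (f x, π x)) ∧ ContDiffOn ℝ ∞ Ψ Ψ.source ∧ ContDiffOn ℝ ∞ Ψ.symm Ψ.target ∧
      ∀ x ∈ Ψ.source, Function.Surjective (fderiv ℝ f x) := by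
  obtain ⟨π, T, hT⟩ := exists_continuousLinearEquiv_prod (D := D) (fderiv ℝ f a) hsurj hdim
  let φ : E → B × D := fun x => (f x, π x)
  have hφ : ContDiffOn ℝ ∞ φ U := hf.prodMk π.contDiff.contDiffOn
  have hder : ∀ x ∈ U, HasFDerivAt φ ((fderiv ℝ f x).prod π) x := fun x hx =>
    (((hf.contDiffAt (hU.mem_nhds hx)).differentiableAt (by simp)).hasFDerivAt).prodMk
      π.hasFDerivAt
  -- Invertibility of the derivative is an open condition. Shrinking to it makes the inverse smooth
  -- on the whole target and keeps `f` submersive on the whole source.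
  let V : Set E := U ∩ fderiv ℝ φ ⁻¹' Set.range ((↑) : (E ≃L[ℝ] B × D) → E →L[ℝ] B × D)
  have hV : IsOpen V := (hφ.continuousOn_fderiv_of_isOpen hU (by simp)).isOpen_inter_preimage hU
    ContinuousLinearEquiv.isOpen
  have haV : a ∈ V := ⟨ha, T, by rw [hT, (hder a ha).fderiv]⟩
  have hda : HasFDerivAt φ (T : E →L[ℝ] B × D) a := hT ▸ hder a ha
  let Ψ := ((hφ.contDiffAt (hU.mem_nhds ha)).toOpenPartialHomeomorph φ hda (by simp)).restrOpen V hV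
  have hΨV : Ψ.source ⊆ V := fun x hx => hx.2
  refine ⟨π, Ψ, ⟨ContDiffAt.mem_toOpenPartialHomeomorph_source _ _ _, haV⟩,
    fun x hx => (hΨV hx).1, fun x => rfl, hφ.mono fun x hx => (hΨV hx).1, fun z hz => ?_,
    fun x hx b => ?_⟩
  · have hz' := hΨV (Ψ.map_target hz)
    obtain ⟨T', hT'⟩ := hz'.2
    refine (Ψ.contDiffAt_symm (f₀' := T') hz ?_ ?_).contDiffWithinAt
    · rw [hT']
      exact (hder _ hz'.1).differentiableAt.hasFDerivAt
    · exact hφ.contDiffAt (hU.mem_nhds hz'.1)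
  · obtain ⟨hxU, T', hT'⟩ := hΨV hx
    obtain ⟨y, hy⟩ := T'.surjective (b, 0)
    refine ⟨y, ?_⟩
    have h1 : (T' : E →L[ℝ] B × D) y = (fderiv ℝ f x).prod π y := by rw [hT', (hder x hxU).fderiv]
    have h2 := congrArg Prod.fst (h1.symm.trans hy)
    exact h2

end LocalDiffeo

/-! ### Differentiability of the piece lengths -/

theorem sideLength_smul {n : ℕ} (g : IsomPlus) (i : Fin n) (P : PlanarPolygon n) :
    sideLength i (g • P) = sideLength i P :=
  (g : Plane ≃ᵃⁱ[ℝ] Plane).dist_map _ _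

theorem finRotate_ne_self {n : ℕ} (hn : 2 ≤ n) (i : Fin n) : finRotate n i ≠ i := by
  obtain ⟨m, rfl⟩ : ∃ m, n = m + 2 := ⟨n - 2, by omega⟩
  rw [finRotate_apply]
  intro h
  simp at h

/-- The polygons without sides of length zero. -/
def nondegeneratePolygons (n : ℕ) : Set (PlanarPolygon n) := {P | ∀ i, P i ≠ P (finRotate n i)}

theorem isOpen_nondegeneratePolygons (n : ℕ) : IsOpen (nondegeneratePolygons n) := by
  have : nondegeneratePolygons n = ⋂ i, {P | P i ≠ P (finRotate n i)} := by
    ext P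
    simp [nondegeneratePolygons]
  rw [this]
  exact isOpen_iInter_of_finite fun i => isOpen_setOf_vertex_ne

theorem contDiffOn_sideLength {n : ℕ} (i : Fin n) :
    ContDiffOn ℝ ∞ (sideLength i) (nondegeneratePolygons n) :=
  ContDiffOn.dist ℝ (by fun_prop) (by fun_prop) fun _ hP => hP i

theorem smul_mem_nondegeneratePolygons {n : ℕ} (g : IsomPlus) {P : PlanarPolygon n}
    (hP : P ∈ nondegeneratePolygons n) : g • P ∈ nondegeneratePolygons n := fun i h =>
  hP i (MulAction.injective g h)

/-- The diagonal action of an isometry is differentiable. -/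
theorem differentiable_smul_polygon {n : ℕ} (g : IsomPlus) :
    Differentiable ℝ fun P : PlanarPolygon n => g • P := by
  rw [differentiable_pi]
  intro i
  have h : Differentiable ℝ fun x : Plane => (g : Plane ≃ᵃⁱ[ℝ] Plane) x :=
    (g : Plane ≃ᵃⁱ[ℝ] Plane).toAffineIsometry.toContinuousAffineMap.contDiff.differentiable
      (n := 1) (by simp)
  exact h.comp (differentiable_apply i)

namespace Necklace

variable (N : Necklace)

/-- The piece is the first one whose closing partial sum exceeds `i`; minimality bounds its opening
partial sum. -/
theorem exists_mem_piece (i : Fin N.n) : ∃ j, i ∈ N.piece j := by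
  have hi : (i : ℕ) < ∑ j, N.count j := i.2
  have hne : ∃ m : ℕ, ∃ h : m < N.k, (i : ℕ) < ∑ a ∈ Finset.Iic (⟨m, h⟩ : Fin N.k), N.count a := by
    refine ⟨N.k - 1, by have := N.k_pos; omega, ?_⟩
    convert! hi using 2
    ext a
    have := a.2
    simp [Fin.le_def]
    omega
  obtain ⟨m, ⟨h, hm⟩, hmin⟩ : ∃ m : ℕ, (∃ h : m < N.k,
      (i : ℕ) < ∑ a ∈ Finset.Iic (⟨m, h⟩ : Fin N.k), N.count a) ∧
      ∀ l < m, ¬ ∃ h : l < N.k, (i : ℕ) < ∑ a ∈ Finset.Iic (⟨l, h⟩ : Fin N.k), N.count a := by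
    classical
    exact ⟨Nat.find hne, Nat.find_spec hne, fun l => Nat.find_min hne⟩
  refine ⟨⟨m, h⟩, ?_⟩
  simp only [piece, Finset.mem_filter, Finset.mem_univ, true_and]
  refine ⟨?_, hm⟩
  by_contra! hlt
  rcases Nat.eq_zero_or_pos m with h0 | h0
  · have : Finset.Iio (⟨m, h⟩ : Fin N.k) = ∅ := by
      ext a
      simp [Fin.lt_def, h0]
    rw [this] at hlt
    simp at hlt
  · refine hmin (m - 1) (by omega) ⟨by omega, ?_⟩
    convert! hlt using 2
    ext a
    simp only [Finset.mem_Iic, Finset.mem_Iio, Fin.lt_def, Fin.le_def]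
    omega

theorem contDiffOn_pieceLengths :
    ContDiffOn ℝ ∞ N.pieceLengths (nondegeneratePolygons N.n) := by
  rw [contDiffOn_pi]
  intro j
  exact ContDiffOn.sum fun i _ => contDiffOn_sideLength i

theorem pieceLengths_smul (g : IsomPlus) (P : PlanarPolygon N.n) :
    N.pieceLengths (g • P) = N.pieceLengths P := by
  funext j
  exact Finset.sum_congr rfl fun i _ => sideLength_smul g i P

theorem differentiableAt_of_mem {P : PlanarPolygon N.n} (hP : P ∈ nondegeneratePolygons N.n) :
    DifferentiableAt ℝ N.pieceLengths P :=
  (N.contDiffOn_pieceLengths.contDiffAt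
    ((isOpen_nondegeneratePolygons _).mem_nhds hP)).differentiableAt (by simp)

/-- If side `i` vanishes, moving vertex `i` alone by `t` gives it length `|t|`, while all other side
lengths are convex in `t`. The symmetric second difference of the piece length is then at least
`2|t|`, but differentiability makes it `o(t)`. The bound `2 ≤ n` ensures that the other end of the
side stays fixed. -/
theorem mem_of_differentiableAt (hn : 2 ≤ N.n) {P : PlanarPolygon N.n}
    (hP : DifferentiableAt ℝ N.pieceLengths P) : P ∈ nondegeneratePolygons N.n := by
  intro i hi
  obtain ⟨j, hj⟩ := N.exists_mem_piece i
  let e : Plane := !₂[1, 0]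
  have he : ‖e‖ = 1 := by
    rw [← sq_eq_sq₀ (norm_nonneg _) zero_le_one, Plane.norm_sq_eq]
    simp [e]
  let V : PlanarPolygon N.n := Pi.single i e
  let φ : ℝ → ℝ := fun t => N.pieceLengths (P + t • V) j
  have hφ : DifferentiableAt ℝ φ 0 := by
    have h1 : DifferentiableAt ℝ (fun Q => N.pieceLengths Q j) (P + (0 : ℝ) • V) := by
      rw [zero_smul, add_zero]
      exact (differentiableAt_pi.1 hP) j
    exact h1.comp (f := fun t : ℝ => P + t • V) 0 (by fun_prop)
  have hφ' : HasDerivAt (fun t => φ t + φ (-t) - 2 * φ 0) 0 0 := by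
    have h2 : HasDerivAt (fun t => φ (-t)) (-deriv φ 0) 0 := by
      have := HasDerivAt.scomp_of_eq (x := (0 : ℝ)) (h := fun t : ℝ => -t) hφ.hasDerivAt
        (hasDerivAt_neg 0) (by simp)
      simpa [Function.comp_def] using this
    have := (hφ.hasDerivAt.add h2).sub_const (2 * φ 0)
    simpa using this
  have hside : ∀ (a : Fin N.n) (t : ℝ),
      2 * sideLength a P ≤ sideLength a (P + t • V) + sideLength a (P + (-t) • V) := by
    intro a t
    simp only [sideLength, dist_eq_norm]
    have := norm_add_le ((P + t • V) a - (P + t • V) (finRotate _ a))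
      ((P + (-t) • V) a - (P + (-t) • V) (finRotate _ a))
    refine le_trans (le_of_eq ?_) this
    have h2 : (P + t • V) a - (P + t • V) (finRotate _ a) +
        ((P + (-t) • V) a - (P + (-t) • V) (finRotate _ a))
        = (2 : ℝ) • (P a - P (finRotate _ a)) := by
      simp only [Pi.add_apply, Pi.smul_apply]
      module
    rw [h2, norm_smul]
    simp
  have hsidei : ∀ t : ℝ, sideLength i (P + t • V) = |t| := by
    intro t
    have h3 : V (finRotate _ i) = 0 := by simp [V, finRotate_ne_self hn i, -finRotate_apply]
    have h4 : V i = e := by simp [V]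
    simp [sideLength, dist_eq_norm, h3, h4, ← hi, norm_smul, he, -finRotate_apply]
  have hge : ∀ t : ℝ, 2 * |t| ≤ φ t + φ (-t) - 2 * φ 0 := by
    intro t
    have h5 : φ t + φ (-t) - 2 * φ 0 = ∑ a ∈ N.piece j, (sideLength a (P + t • V) +
        sideLength a (P + (-t) • V) - 2 * sideLength a P) := by
      simp [φ, pieceLengths, Finset.sum_add_distrib, Finset.mul_sum]
    rw [h5]
    have h6 := Finset.single_le_sum (s := N.piece j) (f := fun a => sideLength a (P + t • V) +
        sideLength a (P + (-t) • V) - 2 * sideLength a P)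
        (fun a _ => by have := hside a t; linarith) hj
    refine le_trans (le_of_eq ?_) h6
    have h7 : sideLength i P = 0 := by simp [sideLength, ← hi, -finRotate_apply]
    simp only [hsidei, h7, abs_neg]
    ring
  rw [hasDerivAt_iff_isLittleO] at hφ'
  -- Restricting to `t ≠ 0` makes the bounds `2|t|` and `|t|` incompatible.
  have h8 := (hφ'.def one_pos).filter_mono (nhdsWithin_le_nhds (s := {0}ᶜ))
  obtain ⟨t, ht, ht0⟩ := (h8.and self_mem_nhdsWithin).exists
  have h9 := hge t
  have h10 : 0 < |t| := abs_pos.2 ht0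
  have h11 : φ t + φ (-t) - 2 * φ 0 ≤ |t| := by
    refine (le_abs_self _).trans ?_
    have h12 : φ 0 + φ 0 - 2 * φ 0 = 0 := by ring
    simpa only [neg_zero, h12, sub_zero, smul_zero, Real.norm_eq_abs, one_mul] using ht
  linarith

/-- The polygons without sides of length zero at which the piece lengths are a submersion. -/
def regularPolygons : Set (PlanarPolygon N.n) :=
  {P | P ∈ nondegeneratePolygons N.n ∧ Function.Surjective (fderiv ℝ N.pieceLengths P)}

/-- Differentiability is traded for the open condition that no side vanishes, where the piece
lengths are smooth. -/
theorem mem_nonsingularConfigurations_iff (hn : 2 ≤ N.n) {P : PlanarPolygon N.n} :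
    P ∈ N.nonsingularConfigurations ↔ N.pieceLengths P = N.length ∧ P ∈ N.regularPolygons := by
  constructor
  · rintro ⟨h1, h2, h3⟩
    exact ⟨funext h1, N.mem_of_differentiableAt hn h2, h3⟩
  · rintro ⟨h1, h2, h3⟩
    exact ⟨congrFun h1, N.differentiableAt_of_mem h2, h3⟩

/-- Invariance of the piece lengths and the chain rule factor the differential at `P` through the
one at `g • P`. -/
theorem smul_mem_regularPolygons (g : IsomPlus) {P : PlanarPolygon N.n}
    (hP : P ∈ N.regularPolygons) : g • P ∈ N.regularPolygons := by
  have h1 := smul_mem_nondegeneratePolygons g hP.1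
  refine ⟨h1, ?_⟩
  have h2 : N.pieceLengths = N.pieceLengths ∘ fun Q => g • Q :=
    funext fun Q => (N.pieceLengths_smul g Q).symm
  have h3 := fderiv_comp P (g := N.pieceLengths) (f := fun Q => g • Q)
    (N.differentiableAt_of_mem h1) (differentiable_smul_polygon g P)
  rw [← h2] at h3
  have h4 := hP.2
  rw [h3] at h4
  exact Function.Surjective.of_comp h4

end Necklace

namespace Necklace

variable (N : Necklace)

/-! ### Normal forms of configurations -/

section Charts

variable {N} {i j : Fin N.n}

theorem pieceLengths_normalForm {P : PlanarPolygon N.n} (h : P i ≠ P j) :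
    N.pieceLengths (normalForm i j P) = N.pieceLengths P := by
  obtain ⟨g, hg⟩ := exists_smul_normalForm h
  conv_rhs => rw [← hg, N.pieceLengths_smul]

theorem normalForm_mem_regularPolygons_iff {P : PlanarPolygon N.n} (h : P i ≠ P j) :
    normalForm i j P ∈ N.regularPolygons ↔ P ∈ N.regularPolygons := by
  obtain ⟨g, hg⟩ := exists_smul_normalForm h
  constructor
  · intro hP
    rw [← hg]
    exact N.smul_mem_regularPolygons g hP
  · intro hP
    rw [← eq_inv_smul_iff] at hg
    rw [hg]
    exact N.smul_mem_regularPolygons _ hP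

variable (N i j) in
/-- The position of the `i`-th vertex, the height of the `j`-th vertex, and the deviation of the
piece lengths from those of the necklace. -/
def normalDefect (P : PlanarPolygon N.n) : (Plane × ℝ) × (Fin N.k → ℝ) :=
  ((P i, P j 1), N.pieceLengths P - N.length)

theorem contDiffOn_normalDefect :
    ContDiffOn ℝ ∞ (N.normalDefect i j) (nondegeneratePolygons N.n) := by
  refine ContDiffOn.prodMk ?_ (N.contDiffOn_pieceLengths.sub contDiffOn_const)
  fun_prop

/-- The normal form map fixes `w`, preserves the piece lengths and lands where the linear conditions
`A` vanish. Its derivative `r'` therefore maps into the kernel of `A` without changing the effect of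
`F'`. After `X` achieves the prescribed value of `A`, a vector `r' Z` corrects the piece lengths. -/
theorem surjective_fderiv_normalDefect (hij : i ≠ j) {w : PlanarPolygon N.n}
    (hw : w ∈ N.regularPolygons) (hnormal : IsNormal i j w) :
    Function.Surjective (fderiv ℝ (N.normalDefect i j) w) := by
  let A : PlanarPolygon N.n →L[ℝ] Plane × ℝ :=
    (ContinuousLinearMap.proj i).prod ((EuclideanSpace.proj 1).comp (ContinuousLinearMap.proj j))
  have hFd := (N.differentiableAt_of_mem hw.1).hasFDerivAt
  set F' := fderiv ℝ N.pieceLengths w with hF'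
  have hd : HasFDerivAt (N.normalDefect i j) (A.prod F') w :=
    A.hasFDerivAt.prodMk (hFd.sub_const N.length)
  rw [hd.fderiv]
  have hU : {P : PlanarPolygon N.n | P i ≠ P j} ∈ nhds w :=
    isOpen_setOf_vertex_ne.mem_nhds hnormal.ne
  have hrd := ((contDiffOn_normalForm.contDiffAt hU).differentiableAt (by simp)).hasFDerivAt
  set r' := fderiv ℝ (normalForm i j) w
  have hrw := hnormal.normalForm_self
  have h1 : F' = F'.comp r' := by
    have h2 : HasFDerivAt (N.pieceLengths ∘ normalForm i j) (F'.comp r') w := by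
      refine HasFDerivAt.comp w ?_ hrd
      rwa [hrw]
    refine HasFDerivAt.unique ?_ h2
    refine hFd.congr_of_eventuallyEq ?_
    filter_upwards [hU] with P hP using pieceLengths_normalForm hP
  have h3 : A.comp r' = 0 := by
    have h4 : HasFDerivAt (A ∘ normalForm i j) (A.comp r') w := A.hasFDerivAt.comp w hrd
    refine HasFDerivAt.unique h4 ?_
    refine (hasFDerivAt_const (0 : Plane × ℝ) w).congr_of_eventuallyEq ?_
    filter_upwards [hU] with P hP
    have h5 := isNormal_normalForm hP
    exact Prod.ext h5.1 h5.2.1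
  rintro ⟨⟨a, b⟩, g⟩
  let X : PlanarPolygon N.n := Pi.single i a + Pi.single j !₂[0, b]
  have hX : A X = (a, b) := by
    simp [A, X, hij, hij.symm]
  obtain ⟨Z, hZ⟩ := hw.2 (g - F' X)
  refine ⟨X + r' Z, ?_⟩
  have h6 : A (r' Z) = 0 := congrArg (fun T : PlanarPolygon N.n →L[ℝ] Plane × ℝ => T Z) h3
  have h7 : F' (r' Z) = F' Z := congrArg (fun T : PlanarPolygon N.n →L[ℝ] Fin N.k → ℝ => T Z) h1.symm
  have h8 : F' Z = g - F' X := hZ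
  refine Prod.ext ?_ ?_
  · change A (X + r' Z) = (a, b)
    rw [map_add, h6, hX, add_zero]
  · change F' (X + r' Z) = g
    rw [map_add, h7, h8, add_sub_cancel]

/-! ### Charts around polygons in normal form -/

variable {D D' : Type} [NormedAddCommGroup D] [NormedSpace ℝ D]
  [NormedAddCommGroup D'] [NormedSpace ℝ D']

variable (N i j) in
/-- Local coordinates on the space of polygons, around a polygon in normal form, which straighten
both the normal form and the piece lengths. -/
structure NormalChart (D' : Type) [NormedAddCommGroup D'] [NormedSpace ℝ D'] where
  chart : OpenPartialHomeomorph (PlanarPolygon N.n) (((Plane × ℝ) × (Fin N.k → ℝ)) × D')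
  coord : PlanarPolygon N.n →L[ℝ] D'
  apply_eq : ∀ x, chart x = (N.normalDefect i j x, coord x)
  contDiffOn : ContDiffOn ℝ ∞ chart chart.source
  contDiffOn_symm : ContDiffOn ℝ ∞ chart.symm chart.target
  mem_regular : ∀ x ∈ chart.source, x ∈ N.regularPolygons
  pos : ∀ x ∈ chart.source, 0 < x j 0

theorem exists_normalChart [FiniteDimensional ℝ D'] (hij : i ≠ j)
    (hdim : 2 * N.n = 3 + N.k + Module.finrank ℝ D') {w : PlanarPolygon N.n}
    (hw : w ∈ N.regularPolygons) (hnormal : IsNormal i j w) :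
    ∃ Φ : N.NormalChart i j D', w ∈ Φ.chart.source := by
  have hdim' : Module.finrank ℝ (PlanarPolygon N.n) =
      Module.finrank ℝ ((Plane × ℝ) × (Fin N.k → ℝ)) + Module.finrank ℝ D' := by
    simp [Module.finrank_pi_fintype]
    omega
  let U : Set (PlanarPolygon N.n) := nondegeneratePolygons N.n ∩ {x | 0 < x j 0}
  have hU : IsOpen U := (isOpen_nondegeneratePolygons _).inter
    (isOpen_lt continuous_const (by fun_prop))
  obtain ⟨π, Ψ, h1, h2, h3, h4, h5, h6⟩ := exists_openPartialHomeomorph_prod hU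
    (contDiffOn_normalDefect.mono Set.inter_subset_left) (a := w) ⟨hw.1, hnormal.2.2⟩
    (surjective_fderiv_normalDefect hij hw hnormal) hdim'
  refine ⟨⟨Ψ, π, h3, h4, h5, fun x hx => ⟨(h2 hx).1, fun g => ?_⟩, fun x hx => (h2 hx).2⟩, h1⟩
  let A : PlanarPolygon N.n →L[ℝ] Plane × ℝ :=
    (ContinuousLinearMap.proj i).prod ((EuclideanSpace.proj 1).comp (ContinuousLinearMap.proj j))
  have hd : HasFDerivAt (N.normalDefect i j) (A.prod (fderiv ℝ N.pieceLengths x)) x :=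
    A.hasFDerivAt.prodMk ((N.differentiableAt_of_mem (h2 hx).1).hasFDerivAt.sub_const N.length)
  -- Surjectivity onto the product contains that of the piece lengths alone.
  obtain ⟨y, hy⟩ := h6 x hx (0, g)
  rw [hd.fderiv] at hy
  exact ⟨y, congrArg Prod.snd hy⟩

/-! ### Lifting charts from normal forms to arbitrary polygons -/

namespace NormalChart

variable (Φ : N.NormalChart i j D')

theorem eq_of_mem_target {s : Fin N.k → ℝ} {y : D'} (h : ((0, s), y) ∈ Φ.chart.target) :
    IsNormal i j (Φ.chart.symm ((0, s), y)) ∧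
      N.pieceLengths (Φ.chart.symm ((0, s), y)) - N.length = s ∧
      Φ.coord (Φ.chart.symm ((0, s), y)) = y := by
  have h1 := Φ.chart.right_inv h
  have h2 := Φ.pos _ (Φ.chart.map_target h)
  rw [Φ.apply_eq] at h1
  have h3 := congrArg Prod.fst h1
  have h4 : (_, _) = ((0 : Plane), (0 : ℝ)) := congrArg Prod.fst h3
  exact ⟨⟨congrArg Prod.fst h4, congrArg Prod.snd h4, h2⟩, congrArg Prod.snd h3,
    congrArg Prod.snd h1⟩

theorem apply_normalForm {x : PlanarPolygon N.n} (h : x i ≠ x j) :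
    Φ.chart (normalForm i j x) =
      ((0, N.pieceLengths x - N.length), Φ.coord (normalForm i j x)) := by
  have h1 := isNormal_normalForm h
  rw [Φ.apply_eq, normalDefect, pieceLengths_normalForm h, h1.1, h1.2.1]
  rfl

/-- The deviation of the piece lengths, the position of the `i`-th vertex and the slope of its join
with the `j`-th vertex, and the coordinates of the normal form. -/
def liftFun (v : Plane) (T : ((Plane × ℝ) × D') ≃L[ℝ] D) (x : PlanarPolygon N.n) :
    (Fin N.k → ℝ) × D :=
  (N.pieceLengths x - N.length, T ((x i, sideSlope i j v x), Φ.coord (normalForm i j x)))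

/-- The polygon with given coordinates. -/
def liftInv (v : Plane) (T : ((Plane × ℝ) × D') ≃L[ℝ] D) (z : (Fin N.k → ℝ) × D) :
    PlanarPolygon N.n :=
  fun l => rotate (slopeDirection v (T.symm z.2).1.2)
    (Φ.chart.symm ((0, z.1), (T.symm z.2).2) l) + (T.symm z.2).1.1

variable (v : Plane) (T : ((Plane × ℝ) × D') ≃L[ℝ] D)

theorem liftInv_eq (z : (Fin N.k → ℝ) × D) : Φ.liftInv v T z = fun l =>
    rotate (slopeDirection v (T.symm z.2).1.2) (Φ.chart.symm ((0, z.1), (T.symm z.2).2) l) +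
      (T.symm z.2).1.1 := rfl

theorem contDiffOn_liftFun : ContDiffOn ℝ ∞ (Φ.liftFun v T)
    ({x | 0 < forward i j v x} ∩ normalForm i j ⁻¹' Φ.chart.source) := by
  have hne : ∀ x ∈ {x : PlanarPolygon N.n | 0 < forward i j v x} ∩
      normalForm i j ⁻¹' Φ.chart.source, x i ≠ x j := fun x hx => ne_of_forward_pos hx.1
  refine ContDiffOn.prodMk ?_ (T.contDiff.comp_contDiffOn (ContDiffOn.prodMk
    (ContDiffOn.prodMk (by fun_prop) ((contDiffOn_sideSlope v).mono Set.inter_subset_left))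
    (Φ.coord.contDiff.comp_contDiffOn (contDiffOn_normalForm.mono hne))))
  refine (N.contDiffOn_pieceLengths.mono fun x hx => ?_).sub contDiffOn_const
  exact ((normalForm_mem_regularPolygons_iff (hne x hx)).1 (Φ.mem_regular _ hx.2)).1

theorem contDiffOn_liftInv (hv : v ≠ 0) : ContDiffOn ℝ ∞ (Φ.liftInv v T)
    {z | ((0, z.1), (T.symm z.2).2) ∈ Φ.chart.target} := by
  have hT : ContDiff ℝ ∞ fun z : (Fin N.k → ℝ) × D => T.symm z.2 :=
    T.symm.contDiff.comp contDiff_snd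
  have h1 : ContDiffOn ℝ ∞ (fun z : (Fin N.k → ℝ) × D =>
      Φ.chart.symm ((0, z.1), (T.symm z.2).2)) {z | ((0, z.1), (T.symm z.2).2) ∈ Φ.chart.target} :=
    Φ.contDiffOn_symm.comp (ContDiff.contDiffOn
      ((contDiff_const.prodMk contDiff_fst).prodMk hT.snd)) fun z hz => hz
  rw [contDiffOn_pi] at h1 ⊢
  intro l
  exact (((contDiff_slopeDirection hv).comp hT.fst.snd).contDiffOn.plane_rotate (h1 l)).add
    hT.fst.fst.contDiffOn

/-- Local coordinates on the space of polygons obtained from coordinates around a normal form. -/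
def lift (hv : v ≠ 0) : OpenPartialHomeomorph (PlanarPolygon N.n) ((Fin N.k → ℝ) × D) where
  toFun := Φ.liftFun v T
  invFun := Φ.liftInv v T
  source := {x | 0 < forward i j v x} ∩ normalForm i j ⁻¹' Φ.chart.source
  target := {z | ((0, z.1), (T.symm z.2).2) ∈ Φ.chart.target}
  map_source' := by
    rintro x ⟨hx, hx'⟩
    simp only [Set.mem_ofPred_eq, liftFun, ContinuousLinearEquiv.symm_apply_apply]
    rw [← Φ.apply_normalForm (ne_of_forward_pos hx)]
    exact Φ.chart.map_source hx'
  map_target' := by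
    intro z hz
    obtain ⟨h1, -, -⟩ := Φ.eq_of_mem_target hz
    refine ⟨h1.forward_slopeDirection hv _ _, ?_⟩
    rw [Set.mem_preimage, liftInv_eq, h1.normalForm_eq (normSq_slopeDirection hv _)]
    exact Φ.chart.map_target hz
  left_inv' := by
    rintro x ⟨hx, hx'⟩
    have hne := ne_of_forward_pos hx
    funext l
    simp only [liftFun, liftInv, ContinuousLinearEquiv.symm_apply_apply]
    rw [← Φ.apply_normalForm hne, Φ.chart.left_inv hx', slopeDirection_sideSlope hx,
      rotate_normalForm hne]
  right_inv' := by
    intro z hz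
    obtain ⟨h1, h2, h3⟩ := Φ.eq_of_mem_target hz
    have hu := normSq_slopeDirection hv (T.symm z.2).1.2
    refine Prod.ext ?_ ?_
    · obtain ⟨g, hg⟩ := IsomPlus.exists_smul_eq _ (T.symm z.2).1.1 hu
      refine Eq.trans ?_ h2
      rw [← N.pieceLengths_smul g (Φ.chart.symm ((0, z.1), (T.symm z.2).2))]
      change N.pieceLengths (Φ.liftInv v T z) - N.length = _
      congr 2
      funext l
      exact (hg _).symm
    · rw [liftInv_eq]
      simp only [liftFun, h1.normalForm_eq hu, h1.sideSlope_slopeDirection hv, h3, h1.1]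
      have h0 : rotate (slopeDirection v (T.symm z.2).1.2) 0 + (T.symm z.2).1.1
          = (T.symm z.2).1.1 := by
        apply ext_coord <;> simp
      rw [h0]
      exact T.apply_symm_apply z.2
  open_source := by
    refine ContinuousOn.isOpen_inter_preimage ?_ ?_ Φ.chart.open_source
    · exact contDiffOn_normalForm.continuousOn.mono fun x hx => ne_of_forward_pos hx
    · exact isOpen_lt continuous_const (continuous_forward v)
  open_target := Φ.chart.open_target.preimage (by fun_prop)
  continuousOn_toFun := (Φ.contDiffOn_liftFun v T).continuousOn
  continuousOn_invFun := (Φ.contDiffOn_liftInv v T hv).continuousOn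

theorem mem_regularPolygons_of_mem_lift_source (hv : v ≠ 0) {x : PlanarPolygon N.n}
    (hx : x ∈ (Φ.lift v T hv).source) : x ∈ N.regularPolygons :=
  (normalForm_mem_regularPolygons_iff (ne_of_forward_pos hx.1)).1 (Φ.mem_regular _ hx.2)

/-- Taking the side of `x` itself as reference vector makes `forward` its squared length. -/
theorem mem_lift_source {x : PlanarPolygon N.n} (hx : x i ≠ x j)
    (hx' : normalForm i j x ∈ Φ.chart.source) :
    x ∈ (Φ.lift (x j - x i) T (sub_ne_zero.2 hx.symm)).source := by
  refine ⟨?_, hx'⟩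
  have h : forward i j (x j - x i) x = ‖x j - x i‖ ^ 2 := by
    rw [norm_sq_eq, forward]
    ring
  have h' := norm_pos_iff.2 (sub_ne_zero.2 hx.symm)
  rw [Set.mem_ofPred_eq, h]
  positivity

/-- The lifted source consists of regular polygons, so only the level condition remains. -/
theorem mem_range_val_iff (hn : 2 ≤ N.n) (hv : v ≠ 0) {x : PlanarPolygon N.n}
    (hx : x ∈ (Φ.lift v T hv).source) :
    x ∈ Set.range (Subtype.val : N.nonsingularConfigurations → PlanarPolygon N.n) ↔
      (Φ.lift v T hv x).1 = 0 := by
  rw [Subtype.range_coe, N.mem_nonsingularConfigurations_iff hn]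
  change _ ↔ N.pieceLengths x - N.length = 0
  rw [sub_eq_zero]
  exact and_iff_left (Φ.mem_regularPolygons_of_mem_lift_source v T hv hx)

end NormalChart

end Charts

/-! ### The moduli space -/

section Moduli

variable {N} {i j : Fin N.n}

theorem vertex_ne (hn : 2 ≤ N.n) (hij : j = finRotate _ i) (P : N.nonsingularConfigurations) :
    P.1 i ≠ P.1 j :=
  hij ▸ ((N.mem_nonsingularConfigurations_iff hn).1 P.2).2.1 i

theorem continuous_quotientMap : Continuous N.quotientMap := continuous_quot_mk

theorem surjective_quotientMap : Function.Surjective N.quotientMap := Quotient.mk_surjective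

/-- The normal form of a class of configurations. -/
def moduliNormalForm (hn : 2 ≤ N.n) (hij : j = finRotate _ i) : N.SmoothModuli → PlanarPolygon N.n :=
  Quotient.lift (fun P : N.nonsingularConfigurations => normalForm i j P.1) (by
    rintro P Q ⟨g, hg⟩
    have hg' : g • Q.1 = P.1 := hg
    change normalForm i j P.1 = normalForm i j Q.1
    rw [← hg', normalForm_smul (vertex_ne hn hij Q)])

theorem moduliNormalForm_quotientMap (hn : 2 ≤ N.n) (hij : j = finRotate _ i)
    (P : N.nonsingularConfigurations) :
    moduliNormalForm hn hij (N.quotientMap P) = normalForm i j P.1 := rfl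

theorem normalForm_mem (hn : 2 ≤ N.n) (hij : j = finRotate _ i) (P : N.nonsingularConfigurations) :
    normalForm i j P.1 ∈ N.nonsingularConfigurations := by
  have h := vertex_ne hn hij P
  have hP := (N.mem_nonsingularConfigurations_iff hn).1 P.2
  exact (N.mem_nonsingularConfigurations_iff hn).2 ⟨(pieceLengths_normalForm h).trans hP.1,
    (normalForm_mem_regularPolygons_iff h).2 hP.2⟩

/-- The normal form is a continuous section of the quotient map, hence an embedding into the
configurations. The Hausdorff property and second countability of the quotient follow from this. -/
theorem isEmbedding_moduliNormalForm (hn : 2 ≤ N.n) (hij : j = finRotate _ i) :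
    Topology.IsEmbedding (moduliNormalForm hn hij) := by
  have hmem : ∀ m, moduliNormalForm hn hij m ∈ N.nonsingularConfigurations := fun m => by
    obtain ⟨P, rfl⟩ := surjective_quotientMap m
    exact normalForm_mem hn hij P
  have hcont : Continuous (moduliNormalForm hn hij) := by
    refine Continuous.quotient_lift ?_ _
    exact contDiffOn_normalForm.continuousOn.comp_continuous continuous_subtype_val
      fun P => vertex_ne hn hij P
  let ρ : N.SmoothModuli → N.nonsingularConfigurations := fun m => ⟨_, hmem m⟩
  have hρ : Continuous ρ := hcont.subtype_mk hmem
  have hinv : Function.LeftInverse N.quotientMap ρ := fun m => by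
    obtain ⟨P, rfl⟩ := surjective_quotientMap m
    obtain ⟨g, hg⟩ := exists_smul_normalForm (vertex_ne hn hij P)
    refine Quotient.sound ⟨g⁻¹, ?_⟩
    exact inv_smul_eq_iff.2 hg.symm
  exact Topology.IsEmbedding.subtypeVal.comp (hinv.isEmbedding continuous_quotientMap hρ)

/-- A regular polygon on the slice with the right piece lengths is its own normal form. Positivity
on the source of `Φ` excludes a vertex `j` on the negative half-axis. -/
theorem NormalChart.mem_range_moduliNormalForm_iff {D' : Type} [NormedAddCommGroup D']
    [NormedSpace ℝ D'] (Φ : N.NormalChart i j D') (hn : 2 ≤ N.n) (hij : j = finRotate _ i)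
    {x : PlanarPolygon N.n} (hx : x ∈ Φ.chart.source) :
    x ∈ Set.range (moduliNormalForm hn hij) ↔ (Φ.chart x).1 = 0 := by
  rw [Φ.apply_eq]
  constructor
  · rintro ⟨m, rfl⟩
    obtain ⟨P, rfl⟩ := surjective_quotientMap m
    have h := vertex_ne hn hij P
    have h1 := isNormal_normalForm h
    have hP := (N.mem_nonsingularConfigurations_iff hn).1 P.2
    rw [moduliNormalForm_quotientMap]
    simp [normalDefect, h1.1, h1.2.1, pieceLengths_normalForm h, hP.1]
  · intro h
    have h0 : (x i, x j 1) = (0, 0) := congrArg Prod.fst h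
    have h1 : N.pieceLengths x - N.length = 0 := congrArg Prod.snd h
    have hnormal : IsNormal i j x := ⟨congrArg Prod.fst h0, congrArg Prod.snd h0, Φ.pos x hx⟩
    have hmem : x ∈ N.nonsingularConfigurations :=
      (N.mem_nonsingularConfigurations_iff hn).2 ⟨sub_eq_zero.1 h1, Φ.mem_regular x hx⟩
    exact ⟨N.quotientMap ⟨x, hmem⟩, hnormal.normalForm_self⟩

end Moduli

/-! ### Smooth structures -/

section Structure

variable {N}

theorem exists_smooth_structures (hn : 2 ≤ N.n) (hk : N.k + 3 ≤ 2 * N.n) :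
    ∃ c : ChartedSpace (EuclideanSpace ℝ (Fin (2 * N.n - N.k))) N.nonsingularConfigurations,
      IsSmoothSubmanifold N.nonsingularConfigurations (2 * N.n - N.k) c ∧
      T2Space N.SmoothModuli ∧ SecondCountableTopology N.SmoothModuli ∧
      ∃ c' : ChartedSpace (EuclideanSpace ℝ (Fin (2 * N.n - N.k - 3))) N.SmoothModuli,
        IsSubmersionStructure (m := 2 * N.n - N.k) N.quotientMap (2 * N.n - N.k - 3) c' ∧
        (∀ c'' : ChartedSpace (EuclideanSpace ℝ (Fin (2 * N.n - N.k - 3))) N.SmoothModuli,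
          IsSubmersionStructure (m := 2 * N.n - N.k) N.quotientMap (2 * N.n - N.k - 3) c'' →
            smoothStructure c'' = smoothStructure c') ∧
        ContMDiff (𝓡 (2 * N.n - N.k - 3)) 𝓘(ℝ, ℝ) ∞ N.moduliArea := by
  let i : Fin N.n := ⟨0, by omega⟩
  obtain ⟨j, hj⟩ : ∃ j, j = finRotate _ i := ⟨_, rfl⟩
  have hij : i ≠ j := hj ▸ (finRotate_ne_self hn i).symm
  let D := EuclideanSpace ℝ (Fin (2 * N.n - N.k))
  let D' := EuclideanSpace ℝ (Fin (2 * N.n - N.k - 3))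
  have hD : Module.finrank ℝ D = 2 * N.n - N.k := finrank_euclideanSpace_fin
  have hD' : Module.finrank ℝ D' = 2 * N.n - N.k - 3 := finrank_euclideanSpace_fin
  have hE : Module.finrank ℝ (PlanarPolygon N.n) = 2 * N.n := by
    simp [Module.finrank_pi_fintype, mul_comm]
  -- The orbit directions account for `2 + 1` dimensions; `hk` excludes truncated subtraction.
  let T : ((Plane × ℝ) × D') ≃L[ℝ] D := ContinuousLinearEquiv.ofFinrankEq (by
    simp only [Module.finrank_prod, hD, hD', finrank_euclideanSpace_fin, Module.finrank_self]
    omega)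
  let T' : (D × (Fin N.k → ℝ)) ≃L[ℝ] PlanarPolygon N.n := ContinuousLinearEquiv.ofFinrankEq (by
    simp only [Module.finrank_prod, hD, hE, Module.finrank_fin_fun]
    omega)
  let ι : N.nonsingularConfigurations → PlanarPolygon N.n := Subtype.val
  have hι : Topology.IsEmbedding ι := Topology.IsEmbedding.subtypeVal
  let ρ := moduliNormalForm hn hj
  have hρ : Topology.IsEmbedding ρ := isEmbedding_moduliNormalForm hn hj
  have hchart : ∀ P : N.nonsingularConfigurations, ∃ Φ : N.NormalChart i j D',
      normalForm i j P.1 ∈ Φ.chart.source := fun P =>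
    exists_normalChart hij (by omega)
      ((N.mem_nonsingularConfigurations_iff hn).1 (normalForm_mem hn hj P)).2
      (isNormal_normalForm (vertex_ne hn hj P))
  choose Φ hΦ using hchart
  have hv : ∀ P : N.nonsingularConfigurations, P.1 j - P.1 i ≠ 0 := fun P =>
    sub_ne_zero.2 (vertex_ne hn hj P).symm
  let L : N.nonsingularConfigurations →
      OpenPartialHomeomorph (PlanarPolygon N.n) ((Fin N.k → ℝ) × D) := fun P =>
    (Φ P).lift _ T (hv P)
  have hL : ∀ P, ι P ∈ (L P).source := fun P =>
    (Φ P).mem_lift_source T (vertex_ne hn hj P) (hΦ P)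
  have hLι : ∀ P, ∀ x ∈ (L P).source, x ∈ Set.range ι ↔ (L P x).1 = 0 := fun P x hx =>
    (Φ P).mem_range_val_iff _ T hn (hv P) hx
  have hL1 : ∀ P, ContDiffOn ℝ ∞ (L P) (L P).source := fun P => (Φ P).contDiffOn_liftFun _ T
  have hL2 : ∀ P, ContDiffOn ℝ ∞ (L P).symm (L P).target := fun P =>
    (Φ P).contDiffOn_liftInv _ T (hv P)
  let e : N.nonsingularConfigurations → OpenPartialHomeomorph N.nonsingularConfigurations D :=
    fun P => sliceChart ι hι (L P) (hLι P) P
  have he : ∀ P, IsSmoothChartAlong ι (e P) := fun P =>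
    isSmoothChartAlong_sliceChart hι (L P) (hLι P) P (hL1 P) (hL2 P)
  have hS : ∀ P, ∃ e : OpenPartialHomeomorph N.nonsingularConfigurations D,
      P ∈ e.source ∧ IsSmoothChartAlong ι e := fun P => ⟨e P, hL P, he P⟩
  have hΦρ : ∀ P, ∀ x ∈ (Φ P).chart.source, x ∈ Set.range ρ ↔ ((Φ P).chart x).1 = 0 :=
    fun P x hx => (Φ P).mem_range_moduliNormalForm_iff hn hj hx
  let e' : N.nonsingularConfigurations → OpenPartialHomeomorph N.SmoothModuli D' :=
    fun P => sliceChart ρ hρ (Φ P).chart (hΦρ P) (N.quotientMap P)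
  have he' : ∀ P, IsSmoothChartAlong ρ (e' P) := fun P =>
    isSmoothChartAlong_sliceChart hρ _ (hΦρ P) _ (Φ P).contDiffOn (Φ P).contDiffOn_symm
  have hM : ∀ m, ∃ e : OpenPartialHomeomorph N.SmoothModuli D',
      m ∈ e.source ∧ IsSmoothChartAlong ρ e := fun m => by
    obtain ⟨P, rfl⟩ := surjective_quotientMap m
    exact ⟨e' P, hΦ P, he' P⟩
  let c : ChartedSpace D N.nonsingularConfigurations := chartedSpaceAlong ι hS
  let c' : ChartedSpace D' N.SmoothModuli := chartedSpaceAlong ρ hM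
  have hmS : IsManifold 𝓘(ℝ, D) ∞ N.nonsingularConfigurations := isManifold_chartedSpaceAlong hS
  have hmM : IsManifold 𝓘(ℝ, D') ∞ N.SmoothModuli := isManifold_chartedSpaceAlong hM
  have himm : Manifold.IsImmersionOfComplement (Fin N.k → ℝ) 𝓘(ℝ, D) 𝓘(ℝ, PlanarPolygon N.n) ∞ ι :=
    fun P => isImmersionAtOfComplement_chartedSpaceAlong hS hι (L P) (hLι P) P (hL1 P) (hL2 P) T'
      (hL P)
  let T'' : D ≃L[ℝ] D' × (Plane × ℝ) := T.symm.trans (ContinuousLinearEquiv.prodComm ℝ _ _)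
  have hsub : Manifold.IsSubmersion 𝓘(ℝ, D) 𝓘(ℝ, D') ∞ N.quotientMap := by
    refine ⟨Plane × ℝ, inferInstance, inferInstance, fun P => ?_⟩
    refine Manifold.IsSubmersionAtOfComplement.mk_of_continuousAt
      continuous_quotientMap.continuousAt T'' (e P) (e' P) (hL P) (hΦ P)
      ((he P).mem_maximalAtlas hS) ((he' P).mem_maximalAtlas hM) ?_
    -- The last component of `T.symm z` is the `Φ`-coordinate of the normal form, which is also the
    -- chart value of the class. So the quotient map reads as a linear projection.
    intro z hz
    have hz' : z ∈ (e P).target := by simpa using hz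
    replace hz : (0, z) ∈ (L P).target := hz'
    have h1 : ι ((e P).symm z) = (L P).symm (0, z) := sliceChart_symm hι (L P) (hLι P) P hz
    have h2 : L P (ι ((e P).symm z)) = (0, z) := by rw [h1, (L P).right_inv hz]
    have h3 : T (_, (Φ P).coord (normalForm i j ((e P).symm z).1)) = z := congrArg Prod.snd h2
    have h4 : (T.symm z).2 = (Φ P).coord (normalForm i j ((e P).symm z).1) := by
      conv_lhs => rw [← h3, T.symm_apply_apply]
    have h5 : e' P (N.quotientMap ((e P).symm z)) =
        (Φ P).coord (normalForm i j ((e P).symm z).1) := by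
      change ((Φ P).chart (normalForm i j ((e P).symm z).1)).2 = _
      rw [(Φ P).apply_eq]
    simpa [T'', h4] using h5
  refine ⟨c, ⟨hmS, himm.isImmersion, hι⟩, hρ.t2Space, hρ.secondCountableTopology, c',
    ⟨hmM, hsub⟩, fun c'' hc'' => ?_, ?_⟩
  · exact maximalAtlas_eq_of_isSubmersion surjective_quotientMap c'' c' hc''.1 hmM hc''.2 hsub
  · refine hsub.contMDiff_of_comp surjective_quotientMap ?_
    have harea : ContDiff ℝ ∞ (orientedArea : PlanarPolygon N.n → ℝ) := by
      unfold orientedArea planeDet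
      fun_prop
    exact harea.contMDiff.comp (contMDiff_chartedSpaceAlong hS)

end Structure

end Necklace

/-! ### Closed polygons with given side lengths -/

/-- The cosine rule gives the cosine `c` of the angle between `u` and the base; the strict triangle
inequalities say `|c| < 1`, so the sine `s` is non-zero. -/
theorem exists_triangle {x y d : ℝ} (hx : 0 < x) (hy : 0 < y) (h1 : |x - y| < d) (h2 : d < x + y) :
    ∃ u v : Plane, ‖u‖ = 1 ∧ ‖v‖ = 1 ∧ x • u + y • v = !₂[d, 0] ∧ planeDet u v ≠ 0 := by
  have hd : 0 < d := (abs_nonneg _).trans_lt h1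
  rw [abs_lt] at h1
  set c := (x ^ 2 + d ^ 2 - y ^ 2) / (2 * x * d) with hc
  have hcd : c * (2 * x * d) = x ^ 2 + d ^ 2 - y ^ 2 := by
    rw [hc]
    field_simp
  have hxd : 0 < 2 * x * d := by positivity
  have hc1 : c < 1 := by
    rw [hc, div_lt_one hxd]
    nlinarith
  have hc2 : -1 < c := by
    rw [hc, lt_div_iff₀ hxd]
    nlinarith
  have hpos : 0 < 1 - c ^ 2 := by nlinarith
  set s := Real.sqrt (1 - c ^ 2)
  have hs : 0 < s := Real.sqrt_pos.2 hpos
  have hss : s ^ 2 = 1 - c ^ 2 := Real.sq_sqrt hpos.le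
  refine ⟨!₂[c, s], !₂[(d - x * c) / y, -(x * s) / y], ?_, ?_, ?_, ?_⟩
  · rw [← sq_eq_sq₀ (norm_nonneg _) zero_le_one, norm_sq_eq]
    simp
    linarith
  · rw [← sq_eq_sq₀ (norm_nonneg _) zero_le_one, norm_sq_eq]
    simp
    field_simp
    linear_combination x ^ 2 * hss - hcd
  · apply ext_coord <;> simp <;> field_simp <;> ring
  · have : planeDet !₂[c, s] !₂[(d - x * c) / y, -(x * s) / y] = -(s * d) / y := by
      simp [planeDet]
      field_simp
      ring
    rw [this]
    exact div_ne_zero (neg_ne_zero.2 (mul_pos hs hd).ne') hy.ne'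

theorem sum_smul_ite {ι : Type*} [DecidableEq ι] (s : Finset ι) {i : ι} (hi : i ∈ s) (ℓ : ι → ℝ)
    (u v : Plane) :
    ∑ t ∈ s, ℓ t • (if t = i then u else v) = ℓ i • u + (∑ t ∈ s, ℓ t - ℓ i) • v := by
  rw [← Finset.add_sum_erase s _ hi, ← Finset.add_sum_erase s ℓ hi, if_pos rfl,
    add_sub_cancel_left, Finset.sum_smul]
  congr 1
  refine Finset.sum_congr rfl fun t ht => ?_
  rw [if_neg (Finset.ne_of_mem_erase ht)]

/-- Positive lengths, each less than half of their sum, are those of a non-collinear system of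
vectors of sum zero. -/
theorem exists_unit_vectors {ι : Type*} [Fintype ι] [Nonempty ι] (ℓ : ι → ℝ) (hpos : ∀ i, 0 < ℓ i)
    (hlt : ∀ i, 2 * ℓ i < ∑ t, ℓ t) :
    ∃ e : ι → Plane, (∀ i, ‖e i‖ = 1) ∧ ∑ i, ℓ i • e i = 0 ∧ ∃ a b, planeDet (e a) (e b) ≠ 0 := by
  classical
  set T := ∑ t, ℓ t with hT
  have hTpos : 0 < T := Finset.sum_pos (fun i _ => hpos i) Finset.univ_nonempty
  -- `A` is a heaviest set of at most half the total weight. If it is strictly below half, any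
  -- further element pushes it above half.
  obtain ⟨A, hA, hmax⟩ := Finset.exists_max_image
    (Finset.univ.filter fun A : Finset ι => 2 * ∑ t ∈ A, ℓ t ≤ T) (fun A => ∑ t ∈ A, ℓ t)
    ⟨∅, by simp [hTpos.le]⟩
  simp only [Finset.mem_filter, Finset.mem_univ, true_and] at hA hmax
  have hsplit : ∀ e : ι → Plane, ∑ t, ℓ t • e t = ∑ t ∈ A, ℓ t • e t + ∑ t ∈ Aᶜ, ℓ t • e t :=
    fun e => (Finset.sum_add_sum_compl A _).symm
  have hsum : ∑ t ∈ A, ℓ t + ∑ t ∈ Aᶜ, ℓ t = T := Finset.sum_add_sum_compl A _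
  have hAc : Aᶜ.Nonempty := by
    rw [Finset.nonempty_iff_ne_empty]
    intro h
    rw [h, Finset.sum_empty] at hsum
    linarith
  obtain ⟨j, hj⟩ := hAc
  have hjA : j ∉ A := Finset.mem_compl.1 hj
  have hℓj := hpos j
  have hℓj' := hlt j
  have hj_le : ℓ j ≤ ∑ t ∈ Aᶜ, ℓ t := Finset.single_le_sum (fun t _ => (hpos t).le) hj
  have hAj : 2 * ∑ t ∈ A, ℓ t < T → T < 2 * (∑ t ∈ A, ℓ t + ℓ j) := by
    intro _
    by_contra! h
    have h1 := hmax (insert j A) (by rw [Finset.sum_insert hjA]; linarith)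
    rw [Finset.sum_insert hjA] at h1
    linarith
  have hAne : A.Nonempty := by
    rw [Finset.nonempty_iff_ne_empty]
    rintro rfl
    rw [Finset.sum_empty] at hAj
    linarith [hAj (by linarith)]
  obtain ⟨i, hi⟩ := hAne
  have hiAc : i ∉ Aᶜ := by simpa using hi
  -- the vectors are `u₁` on `i`, `u₂` on the rest of `A`, `u₃` on `j` and `u₄` elsewhere
  let e : Plane → Plane → Plane → Plane → ι → Plane := fun u₁ u₂ u₃ u₄ t =>
    if t ∈ A then (if t = i then u₁ else u₂) else (if t = j then u₃ else u₄)
  have he : ∀ u₁ u₂ u₃ u₄, ∑ t, ℓ t • e u₁ u₂ u₃ u₄ t =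
      (ℓ i • u₁ + (∑ t ∈ A, ℓ t - ℓ i) • u₂) + (ℓ j • u₃ + (∑ t ∈ Aᶜ, ℓ t - ℓ j) • u₄) := by
    intro u₁ u₂ u₃ u₄
    rw [hsplit, ← sum_smul_ite A hi, ← sum_smul_ite Aᶜ hj]
    congr 1
    · exact Finset.sum_congr rfl fun t ht => by simp only [e, if_pos ht]
    · exact Finset.sum_congr rfl fun t ht => by simp only [e, if_neg (Finset.mem_compl.1 ht)]
  have hnorm : ∀ u₁ u₂ u₃ u₄, ‖u₁‖ = 1 → ‖u₂‖ = 1 → ‖u₃‖ = 1 → ‖u₄‖ = 1 → ∀ t,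
      ‖e u₁ u₂ u₃ u₄ t‖ = 1 := by
    intro u₁ u₂ u₃ u₄ h1 h2 h3 h4 t
    simp only [e]
    split_ifs <;> assumption
  have hunit : ‖(!₂[-1, 0] : Plane)‖ = 1 := by
    rw [← sq_eq_sq₀ (norm_nonneg _) zero_le_one, norm_sq_eq]
    simp
  rcases lt_or_eq_of_le hA with hA' | hA'
  -- Below half: `A`, `j` and the rest, each straightened to one segment, form a non-degenerate
  -- triangle.
  · have h1 := hAj hA'
    have h2 : 0 < ∑ t ∈ A, ℓ t := Finset.sum_pos (fun t _ => hpos t) ⟨i, hi⟩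
    obtain ⟨u, v, hu, hv, huv, hdet⟩ := exists_triangle (d := ∑ t ∈ Aᶜ, ℓ t - ℓ j) h2 hℓj
      (by rw [abs_lt]; constructor <;> linarith) (by linarith)
    refine ⟨e u u v !₂[-1, 0], hnorm _ _ _ _ hu hu hv hunit, ?_, i, j, ?_⟩
    · rw [he]
      have h3 : ℓ i • u + (∑ t ∈ A, ℓ t - ℓ i) • u + (ℓ j • v + (∑ t ∈ Aᶜ, ℓ t - ℓ j) • !₂[-1, 0])
          = (∑ t ∈ A, ℓ t) • u + ℓ j • v + (∑ t ∈ Aᶜ, ℓ t - ℓ j) • !₂[-1, 0] := by module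
      rw [h3, huv]
      apply ext_coord <;> simp
    · simpa [e, hi, hjA] using hdet
  · have hi' := hlt i
    have hiA : 0 < ∑ t ∈ A, ℓ t - ℓ i := by linarith
    have hjA' : 0 < ∑ t ∈ Aᶜ, ℓ t - ℓ j := by linarith
    have hpi := hpos i
    -- Exactly half: the triangle would be flat. Instead `A` and its complement are each bent at one
    -- corner, and the two triangles are glued along a common side `d` slightly shorter than `T /
    -- 2`.
    obtain ⟨d, hd1, hd2⟩ : ∃ d, max |ℓ i - (∑ t ∈ A, ℓ t - ℓ i)| |ℓ j - (∑ t ∈ Aᶜ, ℓ t - ℓ j)| < d ∧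
        d < T / 2 := by
      apply exists_between
      rw [max_lt_iff, abs_lt, abs_lt]
      refine ⟨⟨?_, ?_⟩, ⟨?_, ?_⟩⟩ <;> linarith
    rw [max_lt_iff] at hd1
    obtain ⟨u₁, u₂, h1, h2, h12, hdet⟩ := exists_triangle hpi hiA hd1.1 (by linarith)
    obtain ⟨u₃, u₄, h3, h4, h34, -⟩ := exists_triangle hℓj hjA' hd1.2 (by linarith)
    have hne : ∃ b ∈ A, b ≠ i := by
      by_contra! h
      have : A = {i} := Finset.eq_singleton_iff_unique_mem.2 ⟨hi, h⟩
      rw [this, Finset.sum_singleton] at hiA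
      linarith
    obtain ⟨b, hb, hbi⟩ := hne
    refine ⟨e u₁ u₂ (-u₃) (-u₄), hnorm _ _ _ _ h1 h2 (by rwa [norm_neg]) (by rwa [norm_neg]), ?_,
      i, b, ?_⟩
    · rw [he, h12, smul_neg, smul_neg, ← neg_add, h34, add_neg_cancel]
    · simpa [e, hi, hb, hbi] using hdet

theorem coe_finRotate_eq {n : ℕ} (i : Fin n) :
    (finRotate n i : ℕ) = if (i : ℕ) + 1 = n then 0 else (i : ℕ) + 1 := by
  obtain ⟨m, rfl⟩ : ∃ m, n = m + 1 := ⟨n - 1, by have := i.2; omega⟩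
  split_ifs with h
  · have : i = Fin.last m := Fin.ext (by simp; omega)
    rw [this, finRotate_last]
    rfl
  · have hi : (i : ℕ) < m := by have := i.2; omega
    have := finRotate_of_lt hi
    rw [this]

/-- Vectors of sum zero are the sides of a closed polygon. -/
theorem exists_polygon {n : ℕ} (d : Fin n → Plane) (hd : ∑ i, d i = 0) :
    ∃ P : PlanarPolygon n, ∀ i, P (finRotate n i) - P i = d i := by
  let f : ℕ → Plane := fun l => if h : l < n then d ⟨l, h⟩ else 0
  have hf : ∀ i : Fin n, f i = d i := fun i => by simp [f]
  refine ⟨fun i => ∑ l ∈ Finset.range i, f l, fun i => ?_⟩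
  simp only [coe_finRotate_eq]
  split_ifs with h
  · have h1 : ∑ l ∈ Finset.range n, f l = 0 := by
      rw [Finset.sum_range, ← hd]
      exact Finset.sum_congr rfl fun i _ => hf i
    rw [← h, Finset.sum_range_succ] at h1
    rw [Finset.range_zero, Finset.sum_empty, ← hf i, zero_sub]
    exact neg_eq_of_add_eq_zero_right h1
  · rw [Finset.sum_range_succ, add_sub_cancel_left, hf]

/-- The rotation reaches every index from `0`. -/
theorem eq_of_comp_finRotate {n : ℕ} {β : Type*} {f : Fin n → β}
    (h : ∀ i, f (finRotate n i) = f i) (a b : Fin n) : f a = f b := by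
  have key : ∀ (m : ℕ) (hm : m < n), f ⟨m, hm⟩ = f ⟨0, by omega⟩ := by
    intro m
    induction m with
    | zero => intro _; rfl
    | succ m ih =>
      intro hm
      rw [← ih (by omega), ← h ⟨m, by omega⟩]
      congr 1
      apply Fin.ext
      rw [coe_finRotate_eq, if_neg (by simp; omega)]
  rw [key a a.2, key b b.2]

/-! ### Non-singular configurations exist -/

/-- Compare two derivatives of the squared length, a quadratic form, and divide by the non-zero
length. -/
theorem fderiv_sideLength {n : ℕ} (i : Fin n) {P : PlanarPolygon n}
    (hP : P ∈ nondegeneratePolygons n) (X : PlanarPolygon n) :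
    fderiv ℝ (sideLength i) P X =
      inner ℝ (direction i (finRotate n i) P) (X (finRotate n i) - X i) := by
  set j := finRotate n i
  have hd := (((contDiffOn_sideLength i).contDiffAt
    ((isOpen_nondegeneratePolygons n).mem_nhds hP)).differentiableAt (by simp)).hasFDerivAt
  have h1 := hd.pow 2
  let A : PlanarPolygon n →L[ℝ] Plane :=
    ContinuousLinearMap.proj (R := ℝ) (φ := fun _ => Plane) j - ContinuousLinearMap.proj i
  have h2 := (A.hasFDerivAt (x := P)).norm_sq
  have h3 : (fun Q : PlanarPolygon n => sideLength i Q ^ 2) = fun Q => ‖A Q‖ ^ 2 := by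
    funext Q
    rw [sideLength, dist_comm, dist_eq_norm]
    rfl
  have h1' : HasFDerivAt (fun Q : PlanarPolygon n => ‖A Q‖ ^ 2) _ P := h3 ▸ h1
  have h4 := congrArg (fun T : PlanarPolygon n →L[ℝ] ℝ => T X) (h1'.unique h2)
  have hs : sideLength i P = ‖P j - P i‖ := by
    rw [sideLength, dist_comm, dist_eq_norm]
  have hs0 : ‖P j - P i‖ ≠ 0 := norm_ne_zero_iff.2 (sub_ne_zero.2 (hP i).symm)
  have h5 : 2 * (‖P j - P i‖ * fderiv ℝ (sideLength i) P X)
      = 2 * inner ℝ (P j - P i) (X j - X i) := by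
    simpa [hs, A, mul_assoc, inner_sub_left, inner_sub_right] using h4
  rw [direction, real_inner_smul_left, eq_inv_mul_iff_mul_eq₀ hs0]
  linarith

namespace Necklace

variable {N : Necklace}

theorem fderiv_pieceLengths {P : PlanarPolygon N.n} (hP : P ∈ nondegeneratePolygons N.n)
    (X : PlanarPolygon N.n) (j : Fin N.k) :
    fderiv ℝ N.pieceLengths P X j = ∑ i ∈ N.piece j,
      inner ℝ (direction i (finRotate _ i) P) (X (finRotate _ i) - X i) := by
  have h1 : HasFDerivAt N.pieceLengths
      (ContinuousLinearMap.pi fun j => ∑ i ∈ N.piece j, fderiv ℝ (sideLength i) P) P := by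
    rw [hasFDerivAt_pi]
    intro j
    refine HasFDerivAt.fun_sum fun i _ => ?_
    exact (((contDiffOn_sideLength i).contDiffAt
      ((isOpen_nondegeneratePolygons _).mem_nhds hP)).differentiableAt (by simp)).hasFDerivAt
  rw [h1.fderiv]
  simp only [ContinuousLinearMap.coe_pi', sum_apply]
  exact Finset.sum_congr rfl fun i _ => fderiv_sideLength i hP X

theorem eq_of_mem_piece {i : Fin N.n} {j j' : Fin N.k} (h : i ∈ N.piece j) (h' : i ∈ N.piece j') :
    j = j' := by
  simp only [piece, Finset.mem_filter, Finset.mem_univ, true_and] at h h'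
  by_contra hne
  rcases lt_or_gt_of_ne hne with hlt | hlt
  · have : ∑ a ∈ Finset.Iic j, N.count a ≤ ∑ a ∈ Finset.Iio j', N.count a :=
      Finset.sum_le_sum_of_subset fun a ha =>
        Finset.mem_Iio.2 ((Finset.mem_Iic.1 ha).trans_lt hlt)
    omega
  · have : ∑ a ∈ Finset.Iic j', N.count a ≤ ∑ a ∈ Finset.Iio j, N.count a :=
      Finset.sum_le_sum_of_subset fun a ha =>
        Finset.mem_Iio.2 ((Finset.mem_Iic.1 ha).trans_lt hlt)
    omega

theorem card_piece (j : Fin N.k) : (N.piece j).card = N.count j := by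
  have h1 : ∑ a ∈ Finset.Iic j, N.count a = N.count j + ∑ a ∈ Finset.Iio j, N.count a := by
    rw [← Finset.Iio_insert, Finset.sum_insert (by simp)]
  have h2 : ∑ a ∈ Finset.Iic j, N.count a ≤ N.n :=
    Finset.sum_le_sum_of_subset (Finset.subset_univ _)
  have h3 : (N.piece j).map Fin.valEmbedding =
      Finset.Ico (∑ a ∈ Finset.Iio j, N.count a) (∑ a ∈ Finset.Iic j, N.count a) := by
    ext m
    simp only [piece, Finset.mem_map, Finset.mem_filter, Finset.mem_univ, true_and,
      Fin.valEmbedding_apply, Finset.mem_Ico]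
    constructor
    · rintro ⟨i, hi, rfl⟩
      exact hi
    · intro hm
      exact ⟨⟨m, by omega⟩, hm, rfl⟩
  rw [← Finset.card_map Fin.valEmbedding, h3, Nat.card_Ico]
  omega

/-- A polygon whose sides are not all parallel, or not all equally directed if there is only one
piece, is non-singular. -/
theorem surjective_fderiv_pieceLengths {P : PlanarPolygon N.n}
    (hP : P ∈ nondegeneratePolygons N.n) (a b : Fin N.n)
    (hab : planeDet (direction a (finRotate _ a) P) (direction b (finRotate _ b) P) ≠ 0 ∨
      N.k = 1 ∧ direction a (finRotate _ a) P ≠ direction b (finRotate _ b) P) :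
    Function.Surjective (fderiv ℝ N.pieceLengths P) := by
  classical
  set e : Fin N.n → Plane := fun i => direction i (finRotate _ i) P with he
  have hunit : ∀ i, e i 0 ^ 2 + e i 1 ^ 2 = 1 := fun i => normSq_direction (hP i)
  by_contra hsurj
  have hlt : LinearMap.range (fderiv ℝ N.pieceLengths P : PlanarPolygon N.n →ₗ[ℝ] Fin N.k → ℝ) < ⊤ :=
    lt_top_iff_ne_top.2 fun h => hsurj (LinearMap.range_eq_top.1 h)
  -- A non-zero covector `f` annihilates the image; its coefficients `c` are Lagrange multipliers,
  -- spread over the sides as `μ`.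
  obtain ⟨f, hf0, hf⟩ := Submodule.exists_le_ker_of_lt_top _ hlt
  let c : Fin N.k → ℝ := fun j => f (Pi.single j 1)
  have hfc : ∀ g : Fin N.k → ℝ, f g = ∑ j, g j * c j := fun g => by
    conv_lhs => rw [pi_eq_sum_univ' g, map_sum]
    refine Finset.sum_congr rfl fun j _ => ?_
    rw [map_smul, smul_eq_mul]
  let μ : Fin N.n → ℝ := fun i => ∑ j, if i ∈ N.piece j then c j else 0
  have hμ : ∀ {i j}, i ∈ N.piece j → μ i = c j := fun {i j} hij => by
    change ∑ j, (if i ∈ N.piece j then c j else 0) = c j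
    rw [← Finset.sum_subset (Finset.subset_univ {j}), Finset.sum_singleton, if_pos hij]
    intro j' _ hj'
    rw [if_neg fun h => hj' (Finset.mem_singleton.2 (eq_of_mem_piece h hij))]
  have hzero : ∀ X : PlanarPolygon N.n,
      ∑ i, μ i * inner ℝ (e i) (X (finRotate _ i) - X i) = 0 := by
    intro X
    have h1 : f (fderiv ℝ N.pieceLengths P X) = 0 := hf ⟨X, rfl⟩
    rw [hfc] at h1
    rw [← h1]
    simp only [fderiv_pieceLengths hP, μ, Finset.sum_mul]
    rw [Finset.sum_comm]
    refine Finset.sum_congr rfl fun j _ => ?_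
    simp only [ite_mul, zero_mul, ← Finset.sum_filter, Finset.filter_mem_eq_inter,
      Finset.univ_inter]
    exact Finset.sum_congr rfl fun i _ => mul_comm _ _
  -- Moving a single vertex gives the balance of the tensions of its two adjacent sides.
  have hstep : ∀ i, μ (finRotate _ i) • e (finRotate _ i) = μ i • e i := by
    intro i
    refine ext_inner_right ℝ fun w => ?_
    have h1 := hzero (Pi.single (finRotate _ i) w)
    simp only [inner_sub_right, mul_sub, Finset.sum_sub_distrib] at h1
    rw [Finset.sum_eq_single i, Finset.sum_eq_single (finRotate _ i)] at h1
    · simp only [Pi.single_eq_same] at h1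
      rw [real_inner_smul_left, real_inner_smul_left]
      linarith
    · intro l _ hl
      rw [Pi.single_eq_of_ne hl, inner_zero_right, mul_zero]
    · simp
    · intro l _ hl
      rw [Pi.single_eq_of_ne ((finRotate _).injective.ne hl), inner_zero_right, mul_zero]
    · simp
  have hconst : ∀ i l, μ i • e i = μ l • e l := eq_of_comp_finRotate hstep
  have hsq : ∀ i l, μ i ^ 2 = μ l ^ 2 := by
    intro i l
    have h0 := congrArg (fun x : Plane => x 0) (hconst i l)
    have h1 := congrArg (fun x : Plane => x 1) (hconst i l)
    simp only [PiLp.smul_apply, smul_eq_mul] at h0 h1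
    linear_combination (μ i * e i 0 + μ l * e l 0) * h0 + (μ i * e i 1 + μ l * e l 1) * h1
      - μ i ^ 2 * hunit i + μ l ^ 2 * hunit l
  have hμa : μ a = 0 := by
    have h0 := congrArg (fun x : Plane => x 0) (hconst a b)
    have h1 := congrArg (fun x : Plane => x 1) (hconst a b)
    simp only [PiLp.smul_apply, smul_eq_mul] at h0 h1
    rcases hab with hdet | ⟨hk, hne⟩
    · have h2 : μ a * planeDet (e a) (e b) = 0 := by
        simp only [planeDet]
        linear_combination e b 1 * h0 - e b 0 * h1
      exact (mul_eq_zero.1 h2).resolve_right hdet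
    -- With one piece all multipliers agree, so a non-zero one would make the two directions equal.
    · by_contra h
      obtain ⟨ja, hja⟩ := N.exists_mem_piece a
      obtain ⟨jb, hjb⟩ := N.exists_mem_piece b
      have hj : ja = jb := Fin.ext (by have := ja.2; have := jb.2; omega)
      have h2 : μ a = μ b := by rw [hμ hja, hμ hjb, hj]
      have h3 := hconst a b
      rw [← h2] at h3
      exact hne (smul_right_injective Plane h h3)
  -- All `μ i` have the same square, and every piece contains a side.
  have hc : c = 0 := by
    funext j
    have hne : (N.piece j).Nonempty := by
      rw [← Finset.card_pos, card_piece]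
      exact N.count_pos j
    obtain ⟨i, hi⟩ := hne
    have := hsq i a
    rw [hμa] at this
    rw [← hμ hi]
    simpa using this
  apply hf0
  ext g
  simp [hfc, hc]

/-! ### Consequences of realisability -/

variable (N) in
theorem k_le_n : N.k ≤ N.n := by
  have := Finset.sum_le_sum fun (j : Fin N.k) (_ : j ∈ Finset.univ) =>
    Nat.succ_le_of_lt (N.count_pos j)
  simpa [Necklace.n] using this

/-- A single side would have to be shorter than half of itself. -/
theorem Realisable.two_le_n (hN : N.Realisable) : 2 ≤ N.n := by
  by_contra! h
  have hk := N.k_pos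
  let j : Fin N.k := ⟨0, hk⟩
  have h1 : N.count j ≤ N.n := Finset.single_le_sum (fun _ _ => Nat.zero_le _) (Finset.mem_univ j)
  have h2 := N.count_pos j
  have h3 := N.k_le_n
  have h4 := hN j (by omega)
  have h5 : ∑ i, N.length i = N.length j :=
    Finset.sum_eq_single_of_mem j (Finset.mem_univ j) fun l _ hl =>
      (hl (Fin.ext (by have := l.2; have := j.2; omega))).elim
  have := N.length_pos j
  linarith

/-- Since `k ≤ n` and `n ≥ 2`, only `k = n = 2` could fail, and there each length would be smaller
than the other. -/
theorem Realisable.k_add_three_le (hN : N.Realisable) : N.k + 3 ≤ 2 * N.n := by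
  have hn := hN.two_le_n
  have hk := N.k_pos
  have h3 := N.k_le_n
  by_contra! hlt
  have hk2 : N.k = 2 := by omega
  have hn2 : N.n = 2 := by omega
  obtain ⟨k, hkpos, count, hcount, length, hlength⟩ := N
  obtain rfl : k = 2 := hk2
  have hsum : count 0 + count 1 = 2 := by simpa [Necklace.n, Fin.sum_univ_two] using hn2
  have h0 := hcount 0
  have h1 := hcount 1
  have h4 := hN (0 : Fin 2) (by change count 0 = 1; omega)
  have h5 := hN (1 : Fin 2) (by change count 1 = 1; omega)
  simp only [Fin.sum_univ_two] at h4 h5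
  linarith

theorem Realisable.nonempty_nonsingularConfigurations (hN : N.Realisable) :
    N.nonsingularConfigurations.Nonempty := by
  classical
  have hn := hN.two_le_n
  choose J hJ using N.exists_mem_piece
  have hJ' : ∀ i j, i ∈ N.piece j ↔ J i = j := fun i j =>
    ⟨fun h => eq_of_mem_piece (hJ i) h, fun h => h ▸ hJ i⟩
  have hcount : ∀ j, (0 : ℝ) < N.count j := fun j => Nat.cast_pos.2 (N.count_pos j)
  -- Each piece is divided into sides of equal length.
  let ℓ : Fin N.n → ℝ := fun i => N.length (J i) / N.count (J i)
  have hℓ : ∀ i, 0 < ℓ i := fun i => div_pos (N.length_pos _) (hcount _)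
  have hpiece : ∀ j, ∑ i ∈ N.piece j, ℓ i = N.length j := by
    intro j
    have h1 : ∀ i ∈ N.piece j, ℓ i = N.length j / N.count j := fun i hi => by
      simp only [ℓ, (hJ' i j).1 hi]
    rw [Finset.sum_congr rfl h1, Finset.sum_const, card_piece, nsmul_eq_mul,
      mul_div_cancel₀ _ (hcount j).ne']
  have htotal : ∑ i, ℓ i = ∑ j, N.length j := by
    rw [← Finset.sum_fiberwise (s := Finset.univ) (g := J)]
    refine Finset.sum_congr rfl fun j _ => ?_
    rw [← hpiece j]
    refine Finset.sum_congr ?_ fun _ _ => rfl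
    ext i
    simp [hJ']
  -- it suffices to find suitable directions of the sides
  suffices h : ∃ e : Fin N.n → Plane, (∀ i, ‖e i‖ = 1) ∧ ∑ i, ℓ i • e i = 0 ∧
      ∃ a b, planeDet (e a) (e b) ≠ 0 ∨ N.k = 1 ∧ e a ≠ e b by
    obtain ⟨e, he, hsum, a, b, hab⟩ := h
    obtain ⟨P, hP⟩ := exists_polygon _ hsum
    have hnorm : ∀ i, ‖P (finRotate _ i) - P i‖ = ℓ i := fun i => by
      rw [hP, norm_smul, he, mul_one, Real.norm_of_nonneg (hℓ i).le]
    have hdir : ∀ i, direction i (finRotate _ i) P = e i := fun i => by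
      rw [direction, hnorm, hP, inv_smul_smul₀ (hℓ i).ne']
    have hnd : P ∈ nondegeneratePolygons N.n := fun i h => by
      have := hnorm i
      rw [← h, sub_self, norm_zero] at this
      exact (hℓ i).ne this
    refine ⟨P, (N.mem_nonsingularConfigurations_iff hn).2 ⟨?_, hnd, ?_⟩⟩
    · funext j
      rw [← hpiece j]
      refine Finset.sum_congr rfl fun i _ => ?_
      rw [sideLength, dist_comm, dist_eq_norm, hnorm]
    · exact surjective_fderiv_pieceLengths hnd a b (by simpa only [hdir] using hab)
  -- Here each side is exactly half the perimeter and only a doubled segment closes up; its two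
  -- directions are opposite, which suffices for one piece.
  by_cases hcase : N.k = 1 ∧ N.n = 2
  · obtain ⟨hk, hn2⟩ := hcase
    let a : Fin N.n := ⟨0, by omega⟩
    let b : Fin N.n := ⟨1, by omega⟩
    have hba : b ≠ a := by simp [a, b]
    have huniv : (Finset.univ : Finset (Fin N.n)) = {a, b} := by
      ext i
      have := i.2
      simp only [Finset.mem_univ, Finset.mem_insert, Finset.mem_singleton, true_iff, a, b, Fin.ext_iff]
      omega
    have hℓab : ℓ a = ℓ b := by
      have : J a = J b := Fin.ext (by have := (J a).2; have := (J b).2; omega)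
      simp only [ℓ, this]
    refine ⟨fun i => if i = a then !₂[1, 0] else !₂[-1, 0], fun i => ?_, ?_, a, b, Or.inr ⟨hk, ?_⟩⟩
    · rw [← sq_eq_sq₀ (norm_nonneg _) zero_le_one, norm_sq_eq]
      dsimp only
      split_ifs <;> simp
    · rw [huniv, Finset.sum_pair hba.symm]
      dsimp only
      rw [if_pos rfl, if_neg hba, hℓab]
      apply ext_coord <;> simp
    · simp only [if_true, if_neg hba]
      intro h
      have := congrArg (fun x : Plane => x 0) h
      norm_num at this
  · have : Nonempty (Fin N.n) := ⟨⟨0, by omega⟩⟩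
    suffices hlt : ∀ i, 2 * ℓ i < ∑ t, ℓ t by
      obtain ⟨e, h1, h2, a, b, h3⟩ := exists_unit_vectors ℓ hℓ hlt
      exact ⟨e, h1, h2, a, b, Or.inl h3⟩
    intro i
    rw [htotal]
    have hc := N.count_pos (J i)
    have hL := N.length_pos (J i)
    have hle : N.length (J i) ≤ ∑ j, N.length j :=
      Finset.single_le_sum (fun j _ => (N.length_pos j).le) (Finset.mem_univ _)
    -- A piece with one side is covered by realisability. With two sides the strict inequality comes
    -- from another piece, which exists since the exceptional case is excluded. With three or more,
    -- `2 / 3 < 1` suffices.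
    rcases Nat.lt_or_ge (N.count (J i)) 3 with h | h
    · rcases (show N.count (J i) = 1 ∨ N.count (J i) = 2 by omega) with h' | h'
      · simpa [ℓ, h'] using hN _ h'
      · have hk : N.k ≠ 1 := by
          intro hk
          refine hcase ⟨hk, ?_⟩
          rw [← h']
          refine Finset.sum_eq_single_of_mem _ (Finset.mem_univ _) fun l _ hl => ?_
          exact (hl (Fin.ext (by have := l.2; have := (J i).2; omega))).elim
        have hkpos := N.k_pos
        obtain ⟨j, hj⟩ : ∃ j, j ≠ J i := by
          have : Nontrivial (Fin N.k) := Fin.nontrivial_iff_two_le.2 (by omega)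
          exact exists_ne _
        have := N.length_pos j
        have hlt : N.length (J i) < ∑ j, N.length j :=
          Finset.single_lt_sum hj (Finset.mem_univ _) (Finset.mem_univ _) this
            fun k _ _ => (N.length_pos k).le
        simp only [ℓ, h']
        push_cast
        linarith
    · have h3 : (3 : ℝ) ≤ N.count (J i) := by exact_mod_cast h
      have : ℓ i ≤ N.length (J i) / 3 := div_le_div_of_nonneg_left hL.le (by norm_num) h3
      linarith

end Necklace

end

theorem mainTheorem3 (N : Necklace) (hN : N.Realisable) :
    -- the space is non-empty and no truncation occurs in the dimensions below
    N.nonsingularConfigurations.Nonempty ∧ N.k + 3 ≤ 2 * N.n ∧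
    -- (1) non-singular configurations form a smooth submanifold of dimension `2n - k`
    ∃ c : ChartedSpace (EuclideanSpace ℝ (Fin (2 * N.n - N.k))) N.nonsingularConfigurations,
      IsSmoothSubmanifold N.nonsingularConfigurations (2 * N.n - N.k) c ∧
      -- (2) the quotient is a topological manifold of dimension `2n - k - 3`
      T2Space N.SmoothModuli ∧ SecondCountableTopology N.SmoothModuli ∧
      ∃ c' : ChartedSpace (EuclideanSpace ℝ (Fin (2 * N.n - N.k - 3))) N.SmoothModuli,
        IsSubmersionStructure (m := 2 * N.n - N.k) N.quotientMap (2 * N.n - N.k - 3) c' ∧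
        (∀ c'' : ChartedSpace (EuclideanSpace ℝ (Fin (2 * N.n - N.k - 3))) N.SmoothModuli,
          IsSubmersionStructure (m := 2 * N.n - N.k) N.quotientMap (2 * N.n - N.k - 3) c'' →
            smoothStructure c'' = smoothStructure c') ∧
        -- (3) the oriented area is smooth for this structure
        ContMDiff (𝓡 (2 * N.n - N.k - 3)) 𝓘(ℝ, ℝ) ∞ N.moduliArea := ⟨hN.nonempty_nonsingularConfigurations, hN.k_add_three_le,
    Necklace.exists_smooth_structures hN.two_le_n hN.k_add_three_le⟩
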